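/- **Setting.** A linear adversarial MDP has measurable state and action spaces $\mathcal S,\mathcal A$, horizon $H\ge 1$, an initial state distribution, transition kernels $P_1,\dots,P_H$, and a measurable feature map $\phi:\mathcal S\times\mathcal A\to\mathbb R^d$ with $\|\phi(s,a)\|_2\le 1$, such that $P_h(\cdot\mid s,a)=\langle\phi(s,a),\mu_h\rangle$ for $\mathbb R^d$-valued measures $\mu_h$ with $\|\mu_h(\mathcal S)\|_2\le\sqrt d$. In each episode $k=1,\dots,K$ an adversary chooses, depending on the past (and possibly on private randomness), loss vectors $\theta_{k,h}\in\mathbb R^d$ with $\|\theta_{k,h}\|_2\le\sqrt d$ such that the losses $\ell_{k,h}(s,a)=\langle\phi(s,a),\theta_{k,h}\rangle$ satisfy $|\ell_{k,h}(s,a)|\le 1$ for all $(s,a)$. For a randomized Markov policy $\pi$ let $\phi_{\pi,h}=\mathbb E_\pi[\phi(s_h,a_h)]$ and $V_k^\pi=\mathbb E_\pi\big[\sum_{h=1}^H\ell_{k,h}(s_h,a_h)\big]$, the expectation being over the transitions and the policy only. **Algorithm (GLAP).** The input is a finite nonempty policy class $\Pi$, vectors $\hat\phi_{\pi,h}\in\mathbb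 R^d$ ($\pi\in\Pi$, $1\le h\le H$) that span $\mathbb R^d$ for every $h$, and parameters $\delta\in(0,1)$, $\gamma\in(0,1/2]$. For a probability vector $p$ on $\Pi$ let $\mathbf V_h(p)=\sum_{\pi}p(\pi)\hat\phi_{\pi,h}\hat\phi_{\pi,h}^\top$. For each $h$ let $g_h$ be a G-optimal design, i.e. a minimizer of $\max_{\pi\in\Pi}\hat\phi_{\pi,h}^\top\mathbf V_h(p)^{-1}\hat\phi_{\pi,h}$ over the probability vectors $p$ with $\mathbf V_h(p)$ invertible, and let $g=\frac1H\sum_{h}g_h$, $\eta=\frac{\gamma}{dH^2}$, $w_1\equiv 1$. In episode $k$, put $W_k=\sum_\pi w_k(\pi)$ and $p_k(\pi)=(1-\gamma)\frac{w_k(\pi)}{W_k}+\gamma g(\pi)$; given the past and the losses of the episode, draw $\pi_k\sim p_k$, execute $\pi_k$ in the MDP, and observe $\ell_{k,h}(s_{k,h},a_{k,h})$ for $h=1,\dots,H$. With $\Sigma_{k,h}=\mathbf V_h(p_k)$ let $$\hat\theta_{k,h}=\Sigma_{k,h}^{-1}\hat\phi_{\pi_k,h}\,\ell_{k,h}(s_{k,h},a_{k,h}),\qquad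 \tilde V_k^\pi=\sum_{h=1}^H\Big(\hat\phi_{\pi,h}^\top\hat\theta_{k,h}-2\,\hat\phi_{\pi,h}^\top\Sigma_{k,h}^{-1}\hat\phi_{\pi,h}\sqrt{\tfrac{H\log(1/\delta)}{dK}}\Big),$$ and $w_{k+1}(\pi)=w_k(\pi)\exp(-\eta\tilde V_k^\pi)$. **Claim.** There is a universal constant $C>0$ such that, whenever the feature estimates are $\epsilon$-accurate, i.e. $\|\hat\phi_{\pi,h}-\phi_{\pi,h}\|_2\le\epsilon/\sqrt d$ for all $\pi\in\Pi$ and all $h$, then for every fixed $\pi\in\Pi$, with probability at least $1-\delta$, $$\sum_{k=1}^K\big(V_k^{\pi_k}-V_k^\pi\big)\le C\Big(H\sqrt{dKH\log\tfrac{|\Pi|}{\delta}}+\tfrac{dH^2}{\gamma}\log\tfrac{|\Pi|}{\delta}+\gamma KH+\tfrac{dH^2}{\gamma}\,\epsilon K\Big).$$ -/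

import Mathlib

open MeasureTheory ProbabilityTheory

open scoped Matrix ENNReal

namespace GLAP

/-- A (Markov, randomized) policy over `H` steps: at step `h` and in state `s` the action is
drawn from `kernel h s`. -/
structure Policy (S A : Type*) [MeasurableSpace S] [MeasurableSpace A] (H : ℕ) where
  kernel : Fin H → Kernel S A
  isMarkov : ∀ h, IsMarkovKernel (kernel h)

/-- The loss-free part of a `d`-dimensional linear MDP with horizon `H` (steps `0, …, H - 1`):
initial distribution, transition kernels and feature map, the transitions being linear in the
features. -/
structure LinearMDP (S A : Type*) [MeasurableSpace S] [MeasurableSpace A] (d H : ℕ) where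
  init : Measure S
  isProb_init : IsProbabilityMeasure init
  trans : Fin H → Kernel (S × A) S
  isMarkov_trans : ∀ h, IsMarkovKernel (trans h)
  feat : S × A → EuclideanSpace ℝ (Fin d)
  measurable_feat : Measurable feat
  norm_feat_le : ∀ x, ‖feat x‖ ≤ 1
  trans_linear : ∀ h, ∃ ν : VectorMeasure S (EuclideanSpace ℝ (Fin d)),
    ‖ν Set.univ‖ ≤ √(d : ℝ) ∧
      ∀ x, ∀ B, MeasurableSet B → (trans h x).real B = inner ℝ (feat x) (ν B)

section MDP

variable {S A : Type*} [MeasurableSpace S] [MeasurableSpace A] {d H : ℕ}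

/-- The conditional law of the state-action pair number `n + 1` of an episode given the pairs
`0, …, n`: the next state is drawn from the transition kernel at the current pair and the next
action from the policy at the next state. Beyond the horizon the pair is frozen. -/
noncomputable def LinearMDP.stepKernel (M : LinearMDP S A d H) (π : Policy S A H) (n : ℕ) :
    Kernel ((_i : Finset.Iic n) → S × A) (S × A) :=
  if hn : n + 1 < H then
    (M.trans ⟨n, n.lt_succ_self.trans hn⟩ ⊗ₖ
        Kernel.prodMkLeft (S × A) (π.kernel ⟨n + 1, hn⟩)).comap
      (fun τ => τ ⟨n, Finset.mem_Iic.2 le_rfl⟩) (measurable_pi_apply _)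
  else
    Kernel.deterministic (fun τ => τ ⟨n, Finset.mem_Iic.2 le_rfl⟩) (measurable_pi_apply _)

instance LinearMDP.isMarkovKernel_stepKernel (M : LinearMDP S A d H) (π : Policy S A H) (n : ℕ) :
    IsMarkovKernel (M.stepKernel π n) := by
  have := M.isMarkov_trans
  have := π.isMarkov
  unfold LinearMDP.stepKernel
  split_ifs <;> infer_instance

/-- The law of the first state-action pair. -/
noncomputable def LinearMDP.firstLaw [NeZero H] (M : LinearMDP S A d H) (π : Policy S A H) :
    Measure (S × A) :=
  M.init ⊗ₘ π.kernel 0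

instance LinearMDP.isProbabilityMeasure_firstLaw [NeZero H] (M : LinearMDP S A d H)
    (π : Policy S A H) : IsProbabilityMeasure (M.firstLaw π) := by
  have := M.isProb_init
  have := π.isMarkov 0
  unfold LinearMDP.firstLaw
  infer_instance

/-- The law of the trajectory `(s_h, a_h)`, `h < H`, of one episode in which `π` is executed. -/
noncomputable def LinearMDP.law [NeZero H] (M : LinearMDP S A d H) (π : Policy S A H) :
    Measure (Fin H → S × A) :=
  (Kernel.trajMeasure (X := fun _ => S × A) (M.firstLaw π) (M.stepKernel π)).map
    (fun τ h => τ (h : ℕ))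

instance LinearMDP.isProbabilityMeasure_law [NeZero H] (M : LinearMDP S A d H)
    (π : Policy S A H) : IsProbabilityMeasure (M.law π) := by
  unfold LinearMDP.law
  exact Measure.isProbabilityMeasure_map
    (measurable_pi_lambda _ fun _ => measurable_pi_apply _).aemeasurable

/-- The feature visitation vector of `π` at step `h`, the expectation of the feature of the
`h`-th state-action pair. -/
noncomputable def LinearMDP.visitation [NeZero H] (M : LinearMDP S A d H) (π : Policy S A H)
    (h : Fin H) : EuclideanSpace ℝ (Fin d) :=
  ∫ τ, M.feat (τ h) ∂(M.law π)

/-- The loss of the state-action pair `x` when the loss vector is `θ`. -/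
noncomputable def LinearMDP.loss (M : LinearMDP S A d H) (θ : EuclideanSpace ℝ (Fin d))
    (x : S × A) : ℝ :=
  inner ℝ (M.feat x) θ

/-- The loss vectors `θ 0, …, θ (H - 1)` of an episode are admissible: their norms are at most
`√d`, and all losses lie in `[-1, 1]`. -/
def LinearMDP.Admissible (M : LinearMDP S A d H) (θ : Fin H → EuclideanSpace ℝ (Fin d)) : Prop :=
  (∀ h, ‖θ h‖ ≤ √(d : ℝ)) ∧ ∀ h x, |M.loss (θ h) x| ≤ 1

/-- The value of `π` in an episode with loss vectors `θ`: its expected cumulative loss. -/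
noncomputable def LinearMDP.value [NeZero H] (M : LinearMDP S A d H)
    (θ : Fin H → EuclideanSpace ℝ (Fin d)) (π : Policy S A H) : ℝ :=
  ∫ τ, ∑ h, M.loss (θ h) (τ h) ∂(M.law π)

end MDP

section Algorithm

variable {ι : Type*} [Fintype ι] {d H : ℕ}

/-- The matrix `∑ i, p i • x i (x i)ᵀ`. -/
noncomputable def designMatrix (x : ι → EuclideanSpace ℝ (Fin d)) (p : ι → ℝ) :
    Matrix (Fin d) (Fin d) ℝ :=
  ∑ i, p i • Matrix.vecMulVec (x i).ofLp (x i).ofLp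

/-- The squared norm `xᵀ M⁻¹ x` (used for invertible `M`). -/
noncomputable def invSqNorm (M : Matrix (Fin d) (Fin d) ℝ) (x : EuclideanSpace ℝ (Fin d)) : ℝ :=
  x.ofLp ⬝ᵥ (M⁻¹ *ᵥ x.ofLp)

/-- `p` is a G-optimal design for the vectors `x i`: a probability vector with invertible design
matrix that minimizes the largest `‖x i‖²` in the norm given by the inverse of the design matrix,
among all probability vectors for which this inverse exists. -/
def IsGOptimal (x : ι → EuclideanSpace ℝ (Fin d)) (p : ι → ℝ) : Prop :=
  p ∈ stdSimplex ℝ ι ∧ IsUnit (designMatrix x p) ∧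
    ∀ q ∈ stdSimplex ℝ ι, IsUnit (designMatrix x q) →
      (⨆ i, invSqNorm (designMatrix x p) (x i)) ≤ ⨆ i, invSqNorm (designMatrix x q) (x i)

/-- The exploration distribution, the average over the steps of the designs `g h`. -/
noncomputable def exploration (g : Fin H → ι → ℝ) (i : ι) : ℝ :=
  1 / (H : ℝ) * ∑ h, g h i

/-- The probability of selecting policy `i` when the current weights are `w`. -/
noncomputable def selectProb (γ : ℝ) (g : Fin H → ι → ℝ) (w : ι → ℝ) (i : ι) : ℝ :=
  (1 - γ) * (w i / ∑ j, w j) + γ * exploration g i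

/-- The covariance matrix of the feature estimates `φ` at step `h` under the selection
probabilities `p`. -/
noncomputable def covMatrix (φ : ι → Fin H → EuclideanSpace ℝ (Fin d)) (p : ι → ℝ) (h : Fin H) :
    Matrix (Fin d) (Fin d) ℝ :=
  designMatrix (fun i => φ i h) p

/-- The estimate of the loss vector at step `h`, when policy `c` was selected with the selection
probabilities `p` and the losses `y` were observed. -/
noncomputable def thetaHat (φ : ι → Fin H → EuclideanSpace ℝ (Fin d)) (p : ι → ℝ) (c : ι)
    (y : Fin H → ℝ) (h : Fin H) : EuclideanSpace ℝ (Fin d) :=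
  WithLp.toLp 2 (y h • ((covMatrix φ p h)⁻¹ *ᵥ (φ c h).ofLp))

/-- The optimistic estimate of the value of policy `i`. -/
noncomputable def optValue (φ : ι → Fin H → EuclideanSpace ℝ (Fin d)) (δ : ℝ) (K : ℕ)
    (p : ι → ℝ) (c : ι) (y : Fin H → ℝ) (i : ι) : ℝ :=
  ∑ h, (inner ℝ (φ i h) (thetaHat φ p c y h)
    - 2 * invSqNorm (covMatrix φ p h) (φ i h) * √(H * Real.log (1 / δ) / (d * K)))

/-- The weights at the beginning of episode `k`, for the learning rate `η = γ / (d H²)`, when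
`c j` is the policy selected in episode `j` and `y j` are the losses observed in it. -/
noncomputable def weight (φ : ι → Fin H → EuclideanSpace ℝ (Fin d)) (g : Fin H → ι → ℝ)
    (γ δ : ℝ) (K : ℕ) (c : ℕ → ι) (y : ℕ → Fin H → ℝ) : ℕ → ι → ℝ
  | 0 => fun _ => 1
  | k + 1 => fun i =>
      weight φ g γ δ K c y k i *
        Real.exp (-(γ / (d * H ^ 2)) *
          optValue φ δ K (selectProb γ g (weight φ g γ δ K c y k)) (c k) (y k) i)

/-- The selection probabilities in episode `k`. -/
noncomputable def prob (φ : ι → Fin H → EuclideanSpace ℝ (Fin d)) (g : Fin H → ι → ℝ)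
    (γ δ : ℝ) (K : ℕ) (c : ℕ → ι) (y : ℕ → Fin H → ℝ) (k : ℕ) : ι → ℝ :=
  selectProb γ g (weight φ g γ δ K c y k)

end Algorithm

/-- The processes `θ` (loss vectors), `c` (selected policies) and `τ` (trajectories) form a run
of the algorithm with policy class `(Pi i)_i`, feature estimates `φ` and designs `g` for `K`
episodes `0, …, K - 1` against an adaptive adversary. `ℱ k` is the information available before
episode `k`; it contains the past and possibly private randomness of the adversary. -/
structure IsRun {S A ι Ω : Type*} [MeasurableSpace S] [MeasurableSpace A] [Fintype ι] {d H : ℕ}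
    [NeZero H] (M : LinearMDP S A d H) (Pi : ι → Policy S A H)
    (φ : ι → Fin H → EuclideanSpace ℝ (Fin d)) (g : Fin H → ι → ℝ) (γ δ : ℝ) (K : ℕ)
    {mΩ : MeasurableSpace Ω} (P : Measure Ω) (ℱ : Filtration ℕ mΩ)
    (θ : ℕ → Ω → Fin H → EuclideanSpace ℝ (Fin d)) (c : ℕ → Ω → ι)
    (τ : ℕ → Ω → Fin H → S × A) : Prop where
  /-- The adversary chooses the losses of an episode from the information before it. -/
  measurable_theta : ∀ k < K, Measurable[ℱ k] (θ k)
  admissible_theta : ∀ k < K, ∀ ω, M.Admissible (θ k ω)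
  measurable_policy : ∀ k < K, ∀ i, MeasurableSet[ℱ (k + 1)] (c k ⁻¹' {i})
  measurable_traj : ∀ k < K, Measurable[ℱ (k + 1)] (τ k)
  /-- Given the information before episode `k`, the policy is drawn from the selection
  probabilities, and the trajectory is that of the selected policy in the MDP. -/
  cond_law : ∀ k < K, ∀ i, ∀ B : Set (Fin H → S × A), MeasurableSet B →
    P⟦c k ⁻¹' {i} ∩ τ k ⁻¹' B | ℱ k⟧ =ᵐ[P] fun ω =>
      prob φ g γ δ K (fun j => c j ω) (fun j h => M.loss (θ j ω h) (τ j ω h)) k i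
        * (M.law (Pi i)).real B

end GLAP

/-!
The regret in an episode is compared with the exponential weights algorithm run on the optimistic
value estimates. Write `q` for the normalized weights of the episode, `p` for the selection
probabilities, which mix `q` with exploration, `s` for the sum over the steps of `‖φ i h‖²` in the
norms given by the inverse covariance matrices, and `b = √(H log (1 / δ) / (d K))`, so that the bonus
of policy `i` is `2 b s`.

*Size of the estimates.* By the Kiefer–Wolfowitz bound a G-optimal design has inverse square norms
at most `d` (`IsGOptimal.invSqNorm_le`); the comparison is with a design of largest determinant.
Since `p` dominates `γ / H` times each design, the inverse square norms under `p` are at most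
`d H / γ` (`isMixture_selectProb`), and for `b ≤ 1 / 2` the learning rate times each value estimate
is at most `2` in absolute value. For larger `b` the claimed bound exceeds the trivial bound `2 K H`
(`two_mul_le_of_half_lt_sqrt`).

*Deterministic bound.* The second-order analysis of exponential weights (`sum_normWeight_mul_le`)
bounds the regret along every run by `d H² / γ · log |Π|`, deterministic terms of order `b d H` per
episode, and the sum over the episodes of `deviation - 2 b s` (`IsRun.regret_le_sum_increment`).

*Concentration.* Conditionally on the past, the deviation has mean at most `8 γ H + 4 (d H² / γ) ε`:
with exact features the estimates are unbiased, and their errors enter linearly. Its second moment is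
at most `6 H s + 132 d H²`. The first term is random and may be as large as `d H³ / γ`, but for
`r ≤ b / (3 H)` its contribution to the exponential moment with parameter `r` is absorbed by the
bonus `2 b s` (`IsMixture.sum_mul_one_add_deviation_le`). Hence the exponential of `r` times the sum
of the compensated deviations is a supermartingale (`integral_mul_exp_deviation_le`), and Markov's
inequality bounds that sum by `log (1 / δ) / r` with probability at least `1 - δ`. All random terms
are put into this one supermartingale: a union bound would cost `log (5 / δ) / r`, say, which is too
much when `δ` is close to `1` and the bonus is small.
-/

namespace GLAP

/-! ### Design matrices -/

/-- The bilinear form `xᵀ M⁻¹ y` (used for invertible `M`), whose diagonal is `invSqNorm`. -/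
noncomputable def invInner {d : ℕ} (M : Matrix (Fin d) (Fin d) ℝ) (x y : EuclideanSpace ℝ (Fin d)) :
    ℝ :=
  x.ofLp ⬝ᵥ (M⁻¹ *ᵥ y.ofLp)

section Design

variable {ι : Type*} [Fintype ι] {d : ℕ} {x : ι → EuclideanSpace ℝ (Fin d)} {p : ι → ℝ}

theorem designMatrix_mulVec (x : ι → EuclideanSpace ℝ (Fin d)) (p : ι → ℝ) (u : Fin d → ℝ) :
    designMatrix x p *ᵥ u = ∑ l, (p l * ((x l).ofLp ⬝ᵥ u)) • (x l).ofLp := by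
  rw [designMatrix, Matrix.sum_mulVec]
  refine Finset.sum_congr rfl fun l _ => ?_
  rw [Matrix.smul_mulVec, Matrix.vecMulVec_mulVec]
  ext m
  simp
  ring

theorem dotProduct_designMatrix_mulVec (x : ι → EuclideanSpace ℝ (Fin d)) (p : ι → ℝ)
    (u v : Fin d → ℝ) :
    u ⬝ᵥ (designMatrix x p *ᵥ v) = ∑ l, p l * (u ⬝ᵥ (x l).ofLp) * ((x l).ofLp ⬝ᵥ v) := by
  rw [designMatrix_mulVec, dotProduct_sum]
  refine Finset.sum_congr rfl fun l _ => ?_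
  rw [dotProduct_smul, smul_eq_mul]
  ring

theorem transpose_designMatrix (x : ι → EuclideanSpace ℝ (Fin d)) (p : ι → ℝ) :
    (designMatrix x p)ᵀ = designMatrix x p := by
  simp [designMatrix, Matrix.transpose_sum, Matrix.transpose_vecMulVec]

theorem invInner_designMatrix_comm (u v : EuclideanSpace ℝ (Fin d)) :
    invInner (designMatrix x p) u v = invInner (designMatrix x p) v u := by
  unfold invInner
  rw [dotProduct_comm, ← Matrix.vecMul_transpose, Matrix.transpose_nonsing_inv,
    transpose_designMatrix, Matrix.dotProduct_mulVec]

theorem sum_invInner_mul_dotProduct (hM : IsUnit (designMatrix x p))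
    (u : EuclideanSpace ℝ (Fin d)) (v : Fin d → ℝ) :
    ∑ l, p l * invInner (designMatrix x p) u (x l) * ((x l).ofLp ⬝ᵥ v) = u.ofLp ⬝ᵥ v := by
  have hdet := (Matrix.isUnit_iff_isUnit_det _).1 hM
  have : u.ofLp ⬝ᵥ v =
      (u.ofLp ᵥ* (designMatrix x p)⁻¹) ⬝ᵥ (designMatrix x p *ᵥ v) := by
    rw [← Matrix.dotProduct_mulVec, Matrix.mulVec_mulVec, Matrix.nonsing_inv_mul _ hdet,
      Matrix.one_mulVec]
  rw [this, dotProduct_designMatrix_mulVec]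
  simp only [invInner, Matrix.dotProduct_mulVec]

/-- The form `uᵀ M⁻¹ v` reproduces itself when integrated against the design with matrix `M`. -/
theorem sum_invInner_mul_invInner (hM : IsUnit (designMatrix x p))
    (u v : EuclideanSpace ℝ (Fin d)) :
    ∑ l, p l * invInner (designMatrix x p) u (x l) * invInner (designMatrix x p) (x l) v =
      invInner (designMatrix x p) u v :=
  sum_invInner_mul_dotProduct hM u _

theorem sum_mul_invInner_sq (hM : IsUnit (designMatrix x p)) (u : EuclideanSpace ℝ (Fin d)) :
    ∑ l, p l * invInner (designMatrix x p) u (x l) ^ 2 = invSqNorm (designMatrix x p) u := by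
  change _ = invInner (designMatrix x p) u u
  rw [← sum_invInner_mul_invInner hM u u]
  refine Finset.sum_congr rfl fun l _ => ?_
  rw [invInner_designMatrix_comm (x l) u]
  ring

/-- The average of `‖x l‖²` in the norm given by the inverse design matrix is the dimension: it is
the trace of `M⁻¹ M`. -/
theorem sum_mul_invSqNorm (hM : IsUnit (designMatrix x p)) :
    ∑ l, p l * invSqNorm (designMatrix x p) (x l) = d := by
  have hdet := (Matrix.isUnit_iff_isUnit_det _).1 hM
  have h := congrArg Matrix.trace (Matrix.nonsing_inv_mul _ hdet)
  rw [Matrix.trace_one, Fintype.card_fin] at h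
  rw [← h]
  conv_rhs => arg 1; arg 2; rw [designMatrix]
  rw [Matrix.mul_sum, Matrix.trace_sum]
  refine Finset.sum_congr rfl fun l _ => ?_
  rw [Matrix.mul_smul, Matrix.trace_smul, Matrix.mul_vecMulVec, Matrix.trace_vecMulVec,
    dotProduct_comm, smul_eq_mul, invSqNorm]

theorem invSqNorm_designMatrix_nonneg (hp : ∀ l, 0 ≤ p l) (hM : IsUnit (designMatrix x p))
    (u : EuclideanSpace ℝ (Fin d)) : 0 ≤ invSqNorm (designMatrix x p) u := by
  rw [← sum_mul_invInner_sq hM]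
  exact Finset.sum_nonneg fun l _ => mul_nonneg (hp l) (sq_nonneg _)

theorem abs_invInner_le (hp : ∀ l, 0 ≤ p l) (hM : IsUnit (designMatrix x p))
    {u v : EuclideanSpace ℝ (Fin d)} {r : ℝ} (hu : invSqNorm (designMatrix x p) u ≤ r)
    (hv : invSqNorm (designMatrix x p) v ≤ r) : |invInner (designMatrix x p) u v| ≤ r := by
  have hr : 0 ≤ r := (invSqNorm_designMatrix_nonneg hp hM u).trans hu
  refine abs_le_of_sq_le_sq ?_ hr
  rw [← sum_invInner_mul_invInner hM u v]
  calc _ ≤ (∑ l, p l * invInner (designMatrix x p) u (x l) ^ 2) *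
        ∑ l, p l * invInner (designMatrix x p) v (x l) ^ 2 := by
        refine Finset.sum_sq_le_sum_mul_sum_of_sq_le_mul _ (fun l _ => ?_) (fun l _ => ?_)
          fun l _ => ?_
        · exact mul_nonneg (hp l) (sq_nonneg _)
        · exact mul_nonneg (hp l) (sq_nonneg _)
        · rw [invInner_designMatrix_comm (x l) v]
          exact le_of_eq (by ring)
    _ ≤ r ^ 2 := by
        rw [sum_mul_invInner_sq hM, sum_mul_invInner_sq hM, sq]
        exact mul_le_mul hu hv (invSqNorm_designMatrix_nonneg hp hM v) hr

/-- A design which dominates a multiple of an invertible design is invertible. -/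
theorem isUnit_designMatrix_of_le {g : ι → ℝ} {α : ℝ} (hα : 0 < α) (hg : ∀ l, 0 ≤ g l)
    (hM : IsUnit (designMatrix x g)) (hle : ∀ l, α * g l ≤ p l) : IsUnit (designMatrix x p) := by
  have hp : ∀ l, 0 ≤ p l := fun l => (mul_nonneg hα.le (hg l)).trans (hle l)
  rw [← Matrix.mulVec_injective_iff_isUnit] at hM ⊢
  rw [← Matrix.coe_mulVecLin, ← LinearMap.ker_eq_bot, LinearMap.ker_eq_bot'] at hM ⊢
  intro u hu
  apply hM
  rw [Matrix.mulVecLin_apply] at hu ⊢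
  have h0 : ∑ l, p l * (u ⬝ᵥ (x l).ofLp) * ((x l).ofLp ⬝ᵥ u) = 0 := by
    rw [← dotProduct_designMatrix_mulVec, hu, dotProduct_zero]
  have hnn : ∀ l, 0 ≤ p l * (u ⬝ᵥ (x l).ofLp) * ((x l).ofLp ⬝ᵥ u) := fun l => by
    rw [dotProduct_comm u, mul_assoc]
    exact mul_nonneg (hp l) (mul_self_nonneg _)
  have hz := (Finset.sum_eq_zero_iff_of_nonneg fun l _ => hnn l).1 h0
  rw [designMatrix_mulVec]
  refine Finset.sum_eq_zero fun l hl => ?_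
  have := hz l hl
  rw [dotProduct_comm u, mul_assoc, mul_eq_zero, mul_self_eq_zero] at this
  rcases this with h | h
  · have h1 := hle l
    rw [h] at h1
    have h2 : g l = 0 := le_antisymm (nonpos_of_mul_nonpos_right h1 hα) (hg l)
    rw [h2, zero_mul, zero_smul]
  · rw [h, mul_zero, zero_smul]

/-- If a design dominates `α` times another one, then its inverse norm is at most `α⁻¹` times the
other one: the square norm `s` satisfies `s² ≤ s' · α⁻¹ s` by the Cauchy–Schwarz inequality. -/
theorem invSqNorm_designMatrix_le {g : ι → ℝ} {α r : ℝ} (hα : 0 < α) (hg : ∀ l, 0 ≤ g l)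
    (hM : IsUnit (designMatrix x g)) (hle : ∀ l, α * g l ≤ p l) (u : EuclideanSpace ℝ (Fin d))
    (hr : invSqNorm (designMatrix x g) u ≤ r) : invSqNorm (designMatrix x p) u ≤ r / α := by
  have hp : ∀ l, 0 ≤ p l := fun l => (mul_nonneg hα.le (hg l)).trans (hle l)
  have hMp := isUnit_designMatrix_of_le hα hg hM hle
  set s := invSqNorm (designMatrix x p) u with hs
  have hs0 : 0 ≤ s := invSqNorm_designMatrix_nonneg hp hMp u
  have hr0 : 0 ≤ r := (invSqNorm_designMatrix_nonneg hg hM u).trans hr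
  have h1 : s = ∑ l, g l * invInner (designMatrix x g) u (x l) *
      invInner (designMatrix x p) (x l) u :=
    (sum_invInner_mul_dotProduct hM u _).symm
  have h2 : s ^ 2 ≤ r * (s / α) := by
    calc s ^ 2 ≤ (∑ l, g l * invInner (designMatrix x g) u (x l) ^ 2) *
          ∑ l, g l * invInner (designMatrix x p) u (x l) ^ 2 := by
          conv_lhs => rw [h1]
          refine Finset.sum_sq_le_sum_mul_sum_of_sq_le_mul _ (fun l _ => ?_) (fun l _ => ?_)
            fun l _ => ?_
          · exact mul_nonneg (hg l) (sq_nonneg _)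
          · exact mul_nonneg (hg l) (sq_nonneg _)
          · rw [invInner_designMatrix_comm (x l) u]
            exact le_of_eq (by ring)
      _ ≤ r * (s / α) := by
          refine mul_le_mul ?_ ?_ ?_ hr0
          · rwa [sum_mul_invInner_sq hM]
          · rw [hs, ← sum_mul_invInner_sq hMp, Finset.sum_div]
            refine Finset.sum_le_sum fun l _ => ?_
            rw [le_div_iff₀ hα]
            have := mul_le_mul_of_nonneg_right (hle l)
              (sq_nonneg (invInner (designMatrix x p) u (x l)))
            linarith
          · exact Finset.sum_nonneg fun l _ => mul_nonneg (hg l) (sq_nonneg _)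
  rcases hs0.eq_or_lt with h | h
  · rw [← h]
    positivity
  · refine le_of_mul_le_mul_right ?_ h
    calc s * s = s ^ 2 := (sq s).symm
      _ ≤ _ := h2
      _ = _ := by ring

theorem dotProduct_eq_inner (u v : EuclideanSpace ℝ (Fin d)) :
    u.ofLp ⬝ᵥ v.ofLp = inner ℝ u v := by
  rw [EuclideanSpace.inner_eq_star_dotProduct, star_trivial, dotProduct_comm]

end Design

/-! ### The Kiefer–Wolfowitz bound -/

section KieferWolfowitz

variable {ι : Type*} [Fintype ι] {d : ℕ} {x : ι → EuclideanSpace ℝ (Fin d)} {p : ι → ℝ}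

theorem designMatrix_det_nonneg (hp : ∀ l, 0 ≤ p l) : 0 ≤ (designMatrix x p).det := by
  refine Matrix.PosSemidef.det_nonneg ?_
  refine Matrix.posSemidef_sum _ fun l _ => ?_
  have := Matrix.posSemidef_vecMulVec_self_star (x l).ofLp
  rw [star_trivial] at this
  exact this.smul (hp l)

theorem continuous_designMatrix (x : ι → EuclideanSpace ℝ (Fin d)) :
    Continuous (designMatrix x) := by
  unfold designMatrix
  fun_prop

theorem det_smul_add_smul_vecMulVec {M : Matrix (Fin d) (Fin d) ℝ} (hM : IsUnit M)
    (u : EuclideanSpace ℝ (Fin d)) {t : ℝ} (ht : t < 1) :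
    ((1 - t) • M + t • Matrix.vecMulVec u.ofLp u.ofLp).det =
      M.det * ((1 - t) ^ d * (1 + t / (1 - t) * invSqNorm M u)) := by
  have hdet := (Matrix.isUnit_iff_isUnit_det _).1 hM
  have h1 : (1 - t) • M + t • Matrix.vecMulVec u.ofLp u.ofLp =
      M * ((1 - t) • (1 + Matrix.replicateCol Unit ((t / (1 - t)) • (M⁻¹ *ᵥ u.ofLp)) *
        Matrix.replicateRow Unit u.ofLp)) := by
    rw [← Matrix.vecMulVec_eq, smul_add, Matrix.mul_add, Matrix.smul_vecMulVec, smul_smul,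
      mul_div_cancel₀ _ (by linarith : (1 - t) ≠ 0), Matrix.mul_smul, Matrix.mul_smul,
      Matrix.mul_vecMulVec, Matrix.mulVec_mulVec, Matrix.mul_nonsing_inv _ hdet, Matrix.mul_one,
      Matrix.one_mulVec]
  rw [h1, Matrix.det_mul, Matrix.det_smul, Fintype.card_fin,
    Matrix.det_one_add_replicateCol_mul_replicateRow, dotProduct_smul, smul_eq_mul, invSqNorm]

/-- **Kiefer–Wolfowitz**: a design which maximizes the determinant has largest inverse square norm
at most `d`. Moving the mass `t` to the point `x i` multiplies the determinant by
`(1 - t)ᵈ (1 + t / (1 - t) ‖x i‖²)`, whose derivative at `t = 0` is `‖x i‖² - d`. -/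
theorem invSqNorm_le_of_isMaxOn_det (hp : p ∈ stdSimplex ℝ ι) (hM : IsUnit (designMatrix x p))
    (hmax : IsMaxOn (fun q => (designMatrix x q).det) (stdSimplex ℝ ι) p) (i : ι) :
    invSqNorm (designMatrix x p) (x i) ≤ d := by
  classical
  have hdet := ((Matrix.isUnit_iff_isUnit_det _).1 hM).ne_zero
  have hpos : 0 < (designMatrix x p).det :=
    lt_of_le_of_ne (designMatrix_det_nonneg hp.1) hdet.symm
  set s := invSqNorm (designMatrix x p) (x i) with hs
  have key : ∀ t : ℝ, 0 < t → t < 1 → s - d ≤ d * t * (s - 1) := by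
    intro t ht0 ht1
    have hq : (1 - t) • p + t • (Pi.single i 1 : ι → ℝ) ∈ stdSimplex ℝ ι :=
      convex_stdSimplex ℝ ι hp (single_mem_stdSimplex ℝ i) (by linarith) ht0.le (by ring)
    have hV : designMatrix x ((1 - t) • p + t • (Pi.single i 1 : ι → ℝ)) =
        (1 - t) • designMatrix x p + t • Matrix.vecMulVec (x i).ofLp (x i).ofLp := by
      simp only [designMatrix, Pi.add_apply, Pi.smul_apply, smul_eq_mul, add_smul,
        Finset.sum_add_distrib, mul_smul, ← Finset.smul_sum]
      congr 2
      rw [Finset.sum_eq_single i] <;> simp +contextual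
    have h := hmax hq
    simp only [Set.mem_ofPred_eq] at h
    rw [hV, det_smul_add_smul_vecMulVec hM _ ht1] at h
    have h1 : (1 - t) ^ d * (1 + t / (1 - t) * s) ≤ 1 := by
      by_contra! hc
      exact absurd h (not_le.2 (lt_mul_of_one_lt_right hpos hc))
    have hs0 : 0 ≤ s := invSqNorm_designMatrix_nonneg hp.1 hM _
    have h2 : 1 + d * (-t) ≤ (1 - t) ^ d := by
      have := one_add_mul_le_pow (by linarith : (-2 : ℝ) ≤ -t) d
      rwa [← sub_eq_add_neg] at this
    have h3 : (1 + d * (-t)) * (1 - t + t * s) ≤ 1 - t := by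
      have h1t : 0 < 1 - t := by linarith
      calc (1 + d * (-t)) * (1 - t + t * s) ≤ (1 - t) ^ d * (1 - t + t * s) := by gcongr
        _ = ((1 - t) ^ d * (1 + t / (1 - t) * s)) * (1 - t) := by field_simp
        _ ≤ 1 * (1 - t) := by gcongr
        _ = _ := one_mul _
    have h4 : t * (s - d) ≤ t * (d * t * (s - 1)) := by nlinarith
    exact le_of_mul_le_mul_left h4 ht0
  by_contra! hc
  have hd : (0 : ℝ) ≤ d := Nat.cast_nonneg d
  have hs0 : 0 < s := by linarith
  have hD : 0 < 2 * (d * s + s + 1) := by positivity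
  have h := key ((s - d) / (2 * (d * s + s + 1))) (div_pos (by linarith) hD) (by
    rw [div_lt_one hD]
    nlinarith)
  have h5 : d * ((s - d) / (2 * (d * s + s + 1))) * (s - 1) ≤
      (s - d) * ((d * s) / (2 * (d * s + s + 1))) := by
    have : 0 ≤ d * ((s - d) / (2 * (d * s + s + 1))) :=
      mul_nonneg hd (div_nonneg (by linarith) hD.le)
    calc _ ≤ d * ((s - d) / (2 * (d * s + s + 1))) * s := by gcongr; linarith
      _ = _ := by ring
  have h6 : (d * s) / (2 * (d * s + s + 1)) < 1 := by
    rw [div_lt_one hD]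
    nlinarith [mul_nonneg hd hs0.le]
  nlinarith

theorem IsGOptimal.invSqNorm_le (h : IsGOptimal x p) (i : ι) :
    invSqNorm (designMatrix x p) (x i) ≤ d := by
  obtain ⟨hp, hM, hmin⟩ := h
  have : Nonempty ι := ⟨i⟩
  obtain ⟨q, hq, hmax⟩ := (isCompact_stdSimplex ℝ ι).exists_isMaxOn ⟨p, hp⟩
    (f := fun q => (designMatrix x q).det) (continuous_designMatrix x).matrix_det.continuousOn
  have hqM : IsUnit (designMatrix x q) := by
    have hdet := ((Matrix.isUnit_iff_isUnit_det _).1 hM).ne_zero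
    have hpos : 0 < (designMatrix x p).det :=
      lt_of_le_of_ne (designMatrix_det_nonneg hp.1) hdet.symm
    rw [Matrix.isUnit_iff_isUnit_det, isUnit_iff_ne_zero]
    exact (hpos.trans_le (hmax hp)).ne'
  calc invSqNorm (designMatrix x p) (x i) ≤ ⨆ j, invSqNorm (designMatrix x p) (x j) :=
        le_ciSup (f := fun j => invSqNorm (designMatrix x p) (x j)) (Set.finite_range _).bddAbove i
    _ ≤ ⨆ j, invSqNorm (designMatrix x q) (x j) := hmin q hq hqM
    _ ≤ d := ciSup_le fun j => invSqNorm_le_of_isMaxOn_det hq hqM hmax j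

end KieferWolfowitz

/-! ### A single episode -/

section Episode

variable {ι : Type*} [Fintype ι] {d H : ℕ}

/-- `p` is the mixture `(1 - γ) q + γ e` of probability vectors, and the exploration part `e`
makes all covariance matrices invertible and all the inverse square norms at most `d H / γ`. This
collects what the analysis uses about the selection probabilities `p` of an episode and the
normalized weights `q`. -/
structure IsMixture (φ : ι → Fin H → EuclideanSpace ℝ (Fin d)) (γ : ℝ) (p q : ι → ℝ) : Prop where
  mem_p : p ∈ stdSimplex ℝ ι
  mem_q : q ∈ stdSimplex ℝ ι
  exists_mix : ∃ e ∈ stdSimplex ℝ ι, ∀ l, p l = (1 - γ) * q l + γ * e l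
  isUnit : ∀ h, IsUnit (covMatrix φ p h)
  invSqNorm_le : ∀ l h, invSqNorm (covMatrix φ p h) (φ l h) ≤ d * H / γ

/-- The weights `w` divided by their sum. -/
noncomputable def normWeight (w : ι → ℝ) (l : ι) : ℝ :=
  w l / ∑ j, w j

theorem normWeight_mem_stdSimplex [Nonempty ι] {w : ι → ℝ} (hw : ∀ l, 0 < w l) :
    normWeight w ∈ stdSimplex ℝ ι := by
  have hW : 0 < ∑ j, w j := Finset.sum_pos (fun j _ => hw j) Finset.univ_nonempty
  refine ⟨fun l => div_nonneg (hw l).le hW.le, ?_⟩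
  simp only [normWeight, ← Finset.sum_div]
  exact div_self hW.ne'

theorem exploration_mem_stdSimplex [NeZero H] {g : Fin H → ι → ℝ}
    (hg : ∀ h, g h ∈ stdSimplex ℝ ι) : exploration g ∈ stdSimplex ℝ ι := by
  have hH : (H : ℝ) ≠ 0 := Nat.cast_ne_zero.2 (NeZero.ne H)
  refine ⟨fun l => mul_nonneg (by positivity) (Finset.sum_nonneg fun h _ => (hg h).1 l), ?_⟩
  simp only [exploration, ← Finset.mul_sum]
  rw [Finset.sum_comm, Finset.sum_congr rfl fun h _ => (hg h).2]
  simp [hH]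

theorem isMixture_selectProb [NeZero H] [Nonempty ι] {φ : ι → Fin H → EuclideanSpace ℝ (Fin d)}
    {g : Fin H → ι → ℝ} {γ : ℝ} (hγ : 0 < γ) (hγ' : γ ≤ 1 / 2)
    (hg : ∀ h, IsGOptimal (fun i => φ i h) (g h)) {w : ι → ℝ} (hw : ∀ l, 0 < w l) :
    IsMixture φ γ (selectProb γ g w) (normWeight w) := by
  have hq := normWeight_mem_stdSimplex hw
  have he := exploration_mem_stdSimplex fun h => (hg h).1
  have hH : (0 : ℝ) < H := Nat.cast_pos.2 (Nat.pos_of_ne_zero (NeZero.ne H))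
  have hle : ∀ h l, γ / H * g h l ≤ selectProb γ g w l := by
    intro h l
    have h1 : g h l ≤ ∑ h', g h' l :=
      Finset.single_le_sum (f := fun h' => g h' l) (fun h' _ => (hg h').1.1 l) (Finset.mem_univ h)
    have h2 : 0 ≤ (1 - γ) * (w l / ∑ j, w j) := mul_nonneg (by linarith) (hq.1 l)
    calc γ / H * g h l ≤ γ / H * ∑ h', g h' l := by gcongr
      _ = γ * exploration g l := by rw [exploration]; ring
      _ ≤ selectProb γ g w l := by rw [selectProb]; linarith
  refine ⟨?_, hq, ⟨_, he, fun l => rfl⟩, fun h => ?_, fun l h => ?_⟩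
  · exact convex_stdSimplex ℝ ι hq he (by linarith : 0 ≤ 1 - γ) hγ.le (by ring)
  · exact isUnit_designMatrix_of_le (div_pos hγ hH) (hg h).1.1 (hg h).2.1 (hle h)
  · have := invSqNorm_designMatrix_le (div_pos hγ hH) (hg h).1.1 (hg h).2.1 (hle h) (φ l h)
      ((hg h).invSqNorm_le l)
    rwa [div_div_eq_mul_div] at this

/-- The sum over the steps of the squared norms of the feature estimates of policy `l` in the
norms given by the inverse covariance matrices. -/
noncomputable def sqNormSum (φ : ι → Fin H → EuclideanSpace ℝ (Fin d)) (p : ι → ℝ) (l : ι) : ℝ :=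
  ∑ h, invSqNorm (covMatrix φ p h) (φ l h)

/-- The coefficient of the loss observed at step `h`, when policy `j` was selected, in the
difference of the value estimates of policy `i` and of the mixture `q`. -/
noncomputable def diffCoeff (φ : ι → Fin H → EuclideanSpace ℝ (Fin d)) (p q : ι → ℝ) (i j : ι)
    (h : Fin H) : ℝ :=
  invInner (covMatrix φ p h) (φ i h) (φ j h) -
    ∑ l, q l * invInner (covMatrix φ p h) (φ l h) (φ j h)

theorem optValue_eq (φ : ι → Fin H → EuclideanSpace ℝ (Fin d)) (δ : ℝ) (K : ℕ) (p : ι → ℝ)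
    (c : ι) (y : Fin H → ℝ) (l : ι) :
    optValue φ δ K p c y l = ∑ h, invInner (covMatrix φ p h) (φ l h) (φ c h) * y h -
      2 * √(H * Real.log (1 / δ) / (d * K)) * sqNormSum φ p l := by
  rw [optValue, Finset.sum_sub_distrib, sqNormSum, Finset.mul_sum]
  congr 1
  · refine Finset.sum_congr rfl fun h _ => ?_
    rw [← dotProduct_eq_inner, thetaHat, dotProduct_smul, smul_eq_mul, mul_comm, invInner]
  · exact Finset.sum_congr rfl fun h _ => by ring

namespace IsMixture

variable {φ : ι → Fin H → EuclideanSpace ℝ (Fin d)} {γ : ℝ} {p q : ι → ℝ}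

theorem q_le (hm : IsMixture φ γ p q) (hγ : 0 < γ) (hγ' : γ ≤ 1 / 2) (l : ι) :
    q l ≤ 2 * p l := by
  obtain ⟨e, he, h⟩ := hm.exists_mix
  rw [h]
  nlinarith [mul_nonneg hγ.le (he.1 l), mul_nonneg (by linarith : 0 ≤ 1 - 2 * γ) (hm.mem_q.1 l)]

theorem sum_sub_mul_le (hm : IsMixture φ γ p q) (hγ : 0 < γ) {V : ι → ℝ} {B : ℝ}
    (hV : ∀ l, |V l| ≤ B) : ∑ l, p l * V l - ∑ l, q l * V l ≤ 2 * γ * B := by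
  obtain ⟨e, he, h⟩ := hm.exists_mix
  have h1 : ∑ l, p l * V l - ∑ l, q l * V l = γ * (∑ l, e l * V l - ∑ l, q l * V l) := by
    rw [mul_sub, Finset.mul_sum, Finset.mul_sum, ← Finset.sum_sub_distrib,
      ← Finset.sum_sub_distrib]
    refine Finset.sum_congr rfl fun l _ => ?_
    rw [h]
    ring
  have h2 : ∑ l, e l * V l ≤ B := by
    calc _ ≤ ∑ l, e l * B :=
          Finset.sum_le_sum fun l _ => mul_le_mul_of_nonneg_left (abs_le.1 (hV l)).2 (he.1 l)
      _ = B := by rw [← Finset.sum_mul, he.2, one_mul]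
  have h3 : -B ≤ ∑ l, q l * V l := by
    calc -B = ∑ l, q l * -B := by rw [← Finset.sum_mul, hm.mem_q.2, one_mul]
      _ ≤ _ := Finset.sum_le_sum fun l _ =>
          mul_le_mul_of_nonneg_left (abs_le.1 (hV l)).1 (hm.mem_q.1 l)
  rw [h1]
  nlinarith

theorem invSqNorm_nonneg (hm : IsMixture φ γ p q) (h : Fin H) (u : EuclideanSpace ℝ (Fin d)) :
    0 ≤ invSqNorm (covMatrix φ p h) u :=
  invSqNorm_designMatrix_nonneg hm.mem_p.1 (hm.isUnit h) u

theorem abs_invInner_le (hm : IsMixture φ γ p q) (l j : ι) (h : Fin H) :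
    |invInner (covMatrix φ p h) (φ l h) (φ j h)| ≤ d * H / γ :=
  GLAP.abs_invInner_le hm.mem_p.1 (hm.isUnit h) (hm.invSqNorm_le l h) (hm.invSqNorm_le j h)

theorem sqNormSum_nonneg (hm : IsMixture φ γ p q) (l : ι) : 0 ≤ sqNormSum φ p l :=
  Finset.sum_nonneg fun _ _ => hm.invSqNorm_nonneg _ _

theorem sqNormSum_le (hm : IsMixture φ γ p q) (l : ι) : sqNormSum φ p l ≤ d * H ^ 2 / γ := by
  calc sqNormSum φ p l ≤ ∑ _h : Fin H, (d * H / γ : ℝ) :=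
        Finset.sum_le_sum fun h _ => hm.invSqNorm_le l h
    _ = d * H ^ 2 / γ := by
        rw [Finset.sum_const, Finset.card_univ, Fintype.card_fin, nsmul_eq_mul]
        ring

theorem sum_mul_invSqNorm (hm : IsMixture φ γ p q) (h : Fin H) :
    ∑ l, p l * invSqNorm (covMatrix φ p h) (φ l h) = d :=
  GLAP.sum_mul_invSqNorm (hm.isUnit h)

theorem sum_mul_sqNormSum (hm : IsMixture φ γ p q) : ∑ l, p l * sqNormSum φ p l = d * H := by
  simp only [sqNormSum, Finset.mul_sum]
  rw [Finset.sum_comm, Finset.sum_congr rfl fun h _ => hm.sum_mul_invSqNorm h]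
  rw [Finset.sum_const, Finset.card_univ, Fintype.card_fin, nsmul_eq_mul, mul_comm]

/-- Averages with respect to `q` of nonnegative quantities are at most twice those with respect
to `p`. -/
theorem sum_q_mul_le (hm : IsMixture φ γ p q) (hγ : 0 < γ) (hγ' : γ ≤ 1 / 2) {f : ι → ℝ}
    (hf : ∀ l, 0 ≤ f l) : ∑ l, q l * f l ≤ 2 * ∑ l, p l * f l := by
  rw [Finset.mul_sum]
  refine Finset.sum_le_sum fun l _ => ?_
  rw [← mul_assoc]
  exact mul_le_mul_of_nonneg_right (hm.q_le hγ hγ' l) (hf l)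

theorem abs_diffCoeff_le (hm : IsMixture φ γ p q) (i j : ι) (h : Fin H) :
    |diffCoeff φ p q i j h| ≤ 2 * (d * H / γ) := by
  have h1 : |∑ l, q l * invInner (covMatrix φ p h) (φ l h) (φ j h)| ≤ d * H / γ := by
    calc _ ≤ ∑ l, |q l * invInner (covMatrix φ p h) (φ l h) (φ j h)| :=
          Finset.abs_sum_le_sum_abs _ _
      _ ≤ ∑ l, q l * (d * H / γ) := by
          refine Finset.sum_le_sum fun l _ => ?_
          rw [abs_mul, abs_of_nonneg (hm.mem_q.1 l)]
          exact mul_le_mul_of_nonneg_left (hm.abs_invInner_le l j h) (hm.mem_q.1 l)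
      _ = _ := by rw [← Finset.sum_mul, hm.mem_q.2, one_mul]
  have h2 := abs_le.1 (hm.abs_invInner_le i j h)
  have h3 := abs_le.1 h1
  rw [diffCoeff, abs_le]
  constructor <;> linarith [h2.1, h2.2, h3.1, h3.2]

/-- Jensen's inequality for the square and the probability vector `q`. -/
theorem sq_sum_le (hm : IsMixture φ γ p q) (f : ι → ℝ) :
    (∑ l, q l * f l) ^ 2 ≤ ∑ l, q l * f l ^ 2 := by
  have h := (even_two.convexOn_pow (𝕜 := ℝ)).map_sum_le (t := Finset.univ) (w := q) (p := f)
    (fun l _ => hm.mem_q.1 l) hm.mem_q.2 fun l _ => Set.mem_univ _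
  simpa only [smul_eq_mul] using h

theorem sum_mul_sum_diffCoeff_sq_le (hm : IsMixture φ γ p q) (hγ : 0 < γ) (hγ' : γ ≤ 1 / 2)
    (i : ι) :
    ∑ j, p j * ∑ h, diffCoeff φ p q i j h ^ 2 ≤ 2 * sqNormSum φ p i + 4 * (d * H) := by
  have h1 : ∀ h, ∑ j, p j * diffCoeff φ p q i j h ^ 2 ≤
      2 * invSqNorm (covMatrix φ p h) (φ i h) + 4 * d := by
    intro h
    have h2 : ∀ l, ∑ j, p j * invInner (covMatrix φ p h) (φ l h) (φ j h) ^ 2 =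
        invSqNorm (covMatrix φ p h) (φ l h) := fun l => sum_mul_invInner_sq (hm.isUnit h) _
    have h3 : ∑ j, p j * (∑ l, q l * invInner (covMatrix φ p h) (φ l h) (φ j h)) ^ 2 ≤ 2 * d := by
      calc _ ≤ ∑ j, p j * ∑ l, q l * invInner (covMatrix φ p h) (φ l h) (φ j h) ^ 2 :=
            Finset.sum_le_sum fun j _ => mul_le_mul_of_nonneg_left (hm.sq_sum_le _) (hm.mem_p.1 j)
        _ = ∑ l, q l * invSqNorm (covMatrix φ p h) (φ l h) := by
            simp only [← h2, Finset.mul_sum]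
            rw [Finset.sum_comm]
            exact Finset.sum_congr rfl fun _ _ => Finset.sum_congr rfl fun _ _ => by ring
        _ ≤ 2 * ∑ l, p l * invSqNorm (covMatrix φ p h) (φ l h) :=
            hm.sum_q_mul_le hγ hγ' fun l => hm.invSqNorm_nonneg _ _
        _ = 2 * d := by rw [hm.sum_mul_invSqNorm h]
    calc _ ≤ ∑ j, (2 * (p j * invInner (covMatrix φ p h) (φ i h) (φ j h) ^ 2) +
          2 * (p j * (∑ l, q l * invInner (covMatrix φ p h) (φ l h) (φ j h)) ^ 2)) := by
          refine Finset.sum_le_sum fun j _ => ?_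
          rw [diffCoeff]
          set A := invInner (covMatrix φ p h) (φ i h) (φ j h)
          set B := ∑ l, q l * invInner (covMatrix φ p h) (φ l h) (φ j h)
          nlinarith [mul_nonneg (hm.mem_p.1 j) (sq_nonneg (A + B))]
      _ ≤ _ := by
          rw [Finset.sum_add_distrib, ← Finset.mul_sum, ← Finset.mul_sum, h2]
          linarith
  calc _ = ∑ h, ∑ j, p j * diffCoeff φ p q i j h ^ 2 := by
        simp only [Finset.mul_sum]
        rw [Finset.sum_comm]
    _ ≤ ∑ h, (2 * invSqNorm (covMatrix φ p h) (φ i h) + 4 * d) :=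
        Finset.sum_le_sum fun h _ => h1 h
    _ = _ := by
        rw [Finset.sum_add_distrib, ← Finset.mul_sum, ← sqNormSum, Finset.sum_const,
          Finset.card_univ, Fintype.card_fin, nsmul_eq_mul]
        ring

/-- With exact features, the value estimates are unbiased. -/
theorem sum_mul_sum_diffCoeff_mul_inner (hm : IsMixture φ γ p q) (i : ι)
    (θ : Fin H → EuclideanSpace ℝ (Fin d)) :
    ∑ j, p j * ∑ h, diffCoeff φ p q i j h * inner ℝ (φ j h) (θ h) =
      ∑ h, inner ℝ (φ i h) (θ h) - ∑ l, q l * ∑ h, inner ℝ (φ l h) (θ h) := by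
  have h1 : ∀ l h, ∑ j, p j * invInner (covMatrix φ p h) (φ l h) (φ j h) *
      inner ℝ (φ j h) (θ h) = inner ℝ (φ l h) (θ h) := by
    intro l h
    simp only [← dotProduct_eq_inner]
    exact sum_invInner_mul_dotProduct (hm.isUnit h) _ _
  have h2 : ∀ h, ∑ j, p j * (diffCoeff φ p q i j h * inner ℝ (φ j h) (θ h)) =
      inner ℝ (φ i h) (θ h) - ∑ l, q l * inner ℝ (φ l h) (θ h) := by
    intro h
    conv_rhs => rw [← h1 i h]
    conv_rhs => enter [2, 2, l]; rw [← h1 l h, Finset.mul_sum]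
    rw [Finset.sum_comm, ← Finset.sum_sub_distrib]
    refine Finset.sum_congr rfl fun j _ => ?_
    rw [diffCoeff, sub_mul, mul_sub, Finset.sum_mul, Finset.mul_sum, mul_assoc]
    congr 1
    exact Finset.sum_congr rfl fun l _ => by ring
  simp only [Finset.mul_sum]
  rw [Finset.sum_comm, Finset.sum_congr rfl fun h _ => h2 h, Finset.sum_sub_distrib]
  congr 1
  rw [Finset.sum_comm]

end IsMixture

end Episode

/-! ### Exponential weights -/

theorem exp_le_one_add_add_sq {x : ℝ} (hx : |x| ≤ 2) :
    Real.exp x ≤ 1 + x + 3 / 2 * x ^ 2 := by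
  have hx' := abs_le.1 hx
  have h := abs_le.1 (Real.abs_exp_sub_one_sub_id_le (x := x / 2) (by
    rw [abs_div, abs_two]
    linarith))
  have h1 : Real.exp x = Real.exp (x / 2) ^ 2 := by
    rw [sq, ← Real.exp_add]
    ring_nf
  have h2 : Real.exp (x / 2) ≤ 1 + x / 2 + (x / 2) ^ 2 := by linarith [h.2]
  calc Real.exp x ≤ (1 + x / 2 + (x / 2) ^ 2) ^ 2 := by
        rw [h1]
        exact pow_le_pow_left₀ (Real.exp_nonneg _) h2 2
    _ ≤ _ := by
        have h3 : 0 ≤ x ^ 2 * ((2 - x) * (x + 6)) :=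
          mul_nonneg (sq_nonneg x) (mul_nonneg (by linarith) (by linarith))
        nlinarith

section Hedge

variable {ι : Type*} [Fintype ι]

/-- The regret bound of exponential weights with second-order terms. -/
theorem sum_normWeight_mul_le [Nonempty ι] {w v : ℕ → ι → ℝ} {η : ℝ} (hη : 0 < η)
    (hw0 : ∀ l, w 0 l = 1) (hw : ∀ k l, w (k + 1) l = w k l * Real.exp (-η * v k l)) {K : ℕ}
    (hv : ∀ k < K, ∀ l, |η * v k l| ≤ 2) (i : ι) :
    ∑ k ∈ Finset.range K, (∑ l, normWeight (w k) l * v k l - v k i -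
      3 / 2 * η * ∑ l, normWeight (w k) l * v k l ^ 2) ≤ Real.log (Fintype.card ι) / η := by
  have hpos : ∀ k l, 0 < w k l := by
    intro k
    induction k with
    | zero => simp [hw0]
    | succ k ih => exact fun l => by rw [hw]; exact mul_pos (ih l) (Real.exp_pos _)
  have hWpos : ∀ k, 0 < ∑ l, w k l :=
    fun k => Finset.sum_pos (fun l _ => hpos k l) Finset.univ_nonempty
  have hN : (0 : ℝ) < Fintype.card ι := Nat.cast_pos.2 Fintype.card_pos
  have hwi : ∀ n, w n i = Real.exp (∑ k ∈ Finset.range n, -η * v k i) := by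
    intro n
    induction n with
    | zero => simp [hw0]
    | succ n ih => rw [hw, ih, Finset.sum_range_succ, Real.exp_add]
  have hW : ∀ n ≤ K, ∑ l, w n l ≤ Fintype.card ι * Real.exp (∑ k ∈ Finset.range n,
      (-η * ∑ l, normWeight (w k) l * v k l +
        3 / 2 * η ^ 2 * ∑ l, normWeight (w k) l * v k l ^ 2)) := by
    intro n
    induction n with
    | zero => simp [hw0]
    | succ n ih =>
      intro hn
      rw [Finset.sum_range_succ, Real.exp_add, ← mul_assoc]
      have h1 : ∑ l, w (n + 1) l =
          (∑ l, w n l) * ∑ l, normWeight (w n) l * Real.exp (-η * v n l) := by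
        rw [Finset.mul_sum]
        refine Finset.sum_congr rfl fun l _ => ?_
        rw [hw, normWeight]
        field_simp [(hWpos n).ne']
      have hq := normWeight_mem_stdSimplex (hpos n)
      have h2 : ∑ l, normWeight (w n) l * Real.exp (-η * v n l) ≤
          Real.exp (-η * ∑ l, normWeight (w n) l * v n l +
            3 / 2 * η ^ 2 * ∑ l, normWeight (w n) l * v n l ^ 2) := by
        calc _ ≤ ∑ l, normWeight (w n) l * (1 + -η * v n l + 3 / 2 * (-η * v n l) ^ 2) := by
              refine Finset.sum_le_sum fun l _ => mul_le_mul_of_nonneg_left ?_ (hq.1 l)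
              refine exp_le_one_add_add_sq ?_
              rw [neg_mul, abs_neg]
              exact hv n hn l
          _ = ∑ l, (normWeight (w n) l + (-η * (normWeight (w n) l * v n l) +
                3 / 2 * η ^ 2 * (normWeight (w n) l * v n l ^ 2))) :=
              Finset.sum_congr rfl fun l _ => by ring
          _ = (-η * ∑ l, normWeight (w n) l * v n l +
                3 / 2 * η ^ 2 * ∑ l, normWeight (w n) l * v n l ^ 2) + 1 := by
              rw [Finset.sum_add_distrib, hq.2, Finset.sum_add_distrib, ← Finset.mul_sum,
                ← Finset.mul_sum, add_comm]
          _ ≤ _ := Real.add_one_le_exp _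
      rw [h1]
      exact mul_le_mul (ih (Nat.le_of_succ_le hn)) h2
        (Finset.sum_nonneg fun l _ => mul_nonneg (hq.1 l) (Real.exp_nonneg _)) (by positivity)
  have h := (Finset.single_le_sum (f := w K) (fun l _ => (hpos K l).le) (Finset.mem_univ i)).trans
    (hW K le_rfl)
  rw [hwi, ← Real.exp_log hN, ← Real.exp_add, Real.exp_le_exp] at h
  rw [le_div_iff₀ hη, Finset.sum_mul]
  have h3 : ∑ k ∈ Finset.range K, (∑ l, normWeight (w k) l * v k l - v k i -
      3 / 2 * η * ∑ l, normWeight (w k) l * v k l ^ 2) * η =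
      ∑ k ∈ Finset.range K, -η * v k i - ∑ k ∈ Finset.range K,
        (-η * ∑ l, normWeight (w k) l * v k l +
        3 / 2 * η ^ 2 * ∑ l, normWeight (w k) l * v k l ^ 2) := by
    rw [← Finset.sum_sub_distrib]
    exact Finset.sum_congr rfl fun k _ => by ring
  rw [h3]
  linarith

end Hedge

/-! ### Bounds for the value estimates of an episode -/

section Estimates

variable {ι : Type*} [Fintype ι] {d H : ℕ}

/-- The random part of the bound for the regret in an episode with values `V`, when policy `j` was
selected and the losses `y` were observed: the regret with respect to policy `i`, corrected by the
difference of the value estimates without bonus, plus the bound for the second-order term of the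
exponential weights. -/
noncomputable def deviation (φ : ι → Fin H → EuclideanSpace ℝ (Fin d)) (γ : ℝ) (p q V : ι → ℝ)
    (i j : ι) (y : Fin H → ℝ) : ℝ :=
  V j - V i + ∑ h, diffCoeff φ p q i j h * y h + 6 * (γ / (d * H)) * sqNormSum φ p j

/-- An upper bound for the square of `deviation` which does not depend on the observed losses. -/
noncomputable def deviationSq (φ : ι → Fin H → EuclideanSpace ℝ (Fin d)) (γ : ℝ) (p q : ι → ℝ)
    (i j : ι) : ℝ :=
  3 * (4 * (H : ℝ) ^ 2 + H * ∑ h, diffCoeff φ p q i j h ^ 2 +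
    36 * (γ / (d * H) * sqNormSum φ p j) ^ 2)

theorem sq_sum_mul_le (a y : Fin H → ℝ) (hy : ∀ h, |y h| ≤ 1) :
    (∑ h, a h * y h) ^ 2 ≤ H * ∑ h, a h ^ 2 := by
  have h1 := sq_sum_le_card_mul_sum_sq (s := Finset.univ) (f := fun h => a h * y h)
  rw [Finset.card_univ, Fintype.card_fin] at h1
  refine h1.trans ?_
  refine mul_le_mul_of_nonneg_left (Finset.sum_le_sum fun h _ => ?_) (Nat.cast_nonneg H)
  rw [mul_pow]
  exact mul_le_of_le_one_right (sq_nonneg _) ((sq_le_one_iff_abs_le_one _).2 (hy h))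

theorem abs_sum_mul_le {a y : Fin H → ℝ} {r : ℝ} (ha : ∀ h, |a h| ≤ r) (hy : ∀ h, |y h| ≤ 1) :
    |∑ h, a h * y h| ≤ H * r := by
  calc _ ≤ ∑ h, |a h * y h| := Finset.abs_sum_le_sum_abs _ _
    _ ≤ ∑ _h : Fin H, r := by
        refine Finset.sum_le_sum fun h _ => ?_
        rw [abs_mul]
        exact (mul_le_of_le_one_right (abs_nonneg _) (hy h)).trans (ha h)
    _ = _ := by rw [Finset.sum_const, Finset.card_univ, Fintype.card_fin, nsmul_eq_mul]

namespace IsMixture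

variable {φ : ι → Fin H → EuclideanSpace ℝ (Fin d)} {γ : ℝ} {p q : ι → ℝ}

theorem abs_mul_optValue_le (hm : IsMixture φ γ p q) (hd : 0 < d) (hH : 0 < H) (hγ : 0 < γ)
    {δ : ℝ} {K : ℕ} (hb : √(H * Real.log (1 / δ) / (d * K)) ≤ 1 / 2) (c : ι) {y : Fin H → ℝ}
    (hy : ∀ h, |y h| ≤ 1) (l : ι) : |γ / (d * H ^ 2) * optValue φ δ K p c y l| ≤ 2 := by
  have hd' : (0 : ℝ) < d := Nat.cast_pos.2 hd
  have hH' : (0 : ℝ) < H := Nat.cast_pos.2 hH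
  rw [optValue_eq]
  set b := √(H * Real.log (1 / δ) / (d * K))
  have hb0 : 0 ≤ b := Real.sqrt_nonneg _
  have h1 := abs_le.1 (abs_sum_mul_le (fun h => hm.abs_invInner_le l c h) hy)
  have h2 := hm.sqNormSum_nonneg l
  have h3 := hm.sqNormSum_le l
  have h4 : (H : ℝ) * (d * H / γ) = d * H ^ 2 / γ := by ring
  rw [h4] at h1
  have h5 : 2 * b * sqNormSum φ p l ≤ d * H ^ 2 / γ := by nlinarith
  have h6 : 0 ≤ 2 * b * sqNormSum φ p l := by positivity
  have h7 : γ / (d * H ^ 2) * (d * H ^ 2 / γ) = 1 := by field_simp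
  have h8 : 0 < γ / (d * H ^ 2) := by positivity
  rw [abs_mul, abs_of_pos h8]
  calc _ ≤ γ / (d * H ^ 2) * (2 * (d * H ^ 2 / γ)) := by
        refine mul_le_mul_of_nonneg_left (abs_le.2 ?_) h8.le
        constructor <;> linarith
    _ = 2 := by rw [mul_left_comm, h7, mul_one]

/-- The contribution of an episode to the bound of the regret of exponential weights: the bonus
produces the term `-2 b s` with the random squared norm `s` of policy `i`. -/
theorem optValue_sub_add_le (hm : IsMixture φ γ p q) (hd : 0 < d) (hH : 0 < H) (hγ : 0 < γ)
    (hγ' : γ ≤ 1 / 2) {δ : ℝ} {K : ℕ} (hb : √(H * Real.log (1 / δ) / (d * K)) ≤ 1 / 2) (c : ι)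
    {y : Fin H → ℝ} (hy : ∀ h, |y h| ≤ 1) (i : ι) :
    optValue φ δ K p c y i - ∑ l, q l * optValue φ δ K p c y l +
        3 / 2 * (γ / (d * H ^ 2)) * ∑ l, q l * optValue φ δ K p c y l ^ 2 ≤
      ∑ h, diffCoeff φ p q i c h * y h + 6 * (γ / (d * H)) * sqNormSum φ p c -
        2 * √(H * Real.log (1 / δ) / (d * K)) * sqNormSum φ p i +
        16 * √(H * Real.log (1 / δ) / (d * K)) * (d * H) := by
  have hd' : (0 : ℝ) < d := Nat.cast_pos.2 hd
  have hH' : (0 : ℝ) < H := Nat.cast_pos.2 hH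
  simp only [optValue_eq]
  set b := √(H * Real.log (1 / δ) / (d * K))
  have hb0 : 0 ≤ b := Real.sqrt_nonneg _
  set A : ι → ℝ := fun l => ∑ h, invInner (covMatrix φ p h) (φ l h) (φ c h) * y h with hA
  have h1 : ∑ l, q l * (A l - 2 * b * sqNormSum φ p l) =
      ∑ l, q l * A l - 2 * b * ∑ l, q l * sqNormSum φ p l := by
    rw [Finset.mul_sum, ← Finset.sum_sub_distrib]
    exact Finset.sum_congr rfl fun l _ => by ring
  have h2 : ∑ h, diffCoeff φ p q i c h * y h = A i - ∑ l, q l * A l := by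
    simp only [hA, diffCoeff, sub_mul, Finset.sum_sub_distrib, Finset.mul_sum, Finset.sum_mul]
    congr 1
    rw [Finset.sum_comm]
    exact Finset.sum_congr rfl fun _ _ => Finset.sum_congr rfl fun _ _ => by ring
  have h3 : ∑ l, q l * sqNormSum φ p l ≤ 2 * (d * H) := by
    rw [← hm.sum_mul_sqNormSum]
    exact hm.sum_q_mul_le hγ hγ' hm.sqNormSum_nonneg
  have h4 : ∑ l, p l * A l ^ 2 ≤ H * sqNormSum φ p c := by
    calc _ ≤ ∑ l, p l * (H * ∑ h, invInner (covMatrix φ p h) (φ l h) (φ c h) ^ 2) :=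
          Finset.sum_le_sum fun l _ =>
            mul_le_mul_of_nonneg_left (sq_sum_mul_le _ _ hy) (hm.mem_p.1 l)
      _ = H * ∑ h, ∑ l, p l * invInner (covMatrix φ p h) (φ c h) (φ l h) ^ 2 := by
          simp only [Finset.mul_sum]
          rw [Finset.sum_comm]
          refine Finset.sum_congr rfl fun h _ => Finset.sum_congr rfl fun l _ => ?_
          rw [covMatrix, invInner_designMatrix_comm]
          ring
      _ = _ := by
          rw [sqNormSum]
          congr 1
          exact Finset.sum_congr rfl fun h _ => sum_mul_invInner_sq (hm.isUnit h) _
  have h5 : ∑ l, q l * (A l - 2 * b * sqNormSum φ p l) ^ 2 ≤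
      4 * (H * sqNormSum φ p c) + 16 * b ^ 2 * (d * H ^ 2 / γ) * (d * H) := by
    calc _ ≤ 2 * ∑ l, p l * (A l - 2 * b * sqNormSum φ p l) ^ 2 :=
          hm.sum_q_mul_le hγ hγ' fun l => sq_nonneg _
      _ ≤ 2 * ∑ l, (2 * (p l * A l ^ 2) +
            8 * b ^ 2 * (d * H ^ 2 / γ) * (p l * sqNormSum φ p l)) := by
          gcongr with l
          have h6 : (A l - 2 * b * sqNormSum φ p l) ^ 2 ≤
              2 * A l ^ 2 + 8 * b ^ 2 * (d * H ^ 2 / γ) * sqNormSum φ p l := by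
            have h7 : sqNormSum φ p l ^ 2 ≤ d * H ^ 2 / γ * sqNormSum φ p l := by
              rw [sq]
              exact mul_le_mul_of_nonneg_right (hm.sqNormSum_le l) (hm.sqNormSum_nonneg l)
            nlinarith [sq_nonneg (A l + 2 * b * sqNormSum φ p l),
              mul_le_mul_of_nonneg_left h7 (sq_nonneg b)]
          calc _ ≤ p l * (2 * A l ^ 2 + 8 * b ^ 2 * (d * H ^ 2 / γ) * sqNormSum φ p l) :=
                mul_le_mul_of_nonneg_left h6 (hm.mem_p.1 l)
            _ = _ := by ring
      _ ≤ _ := by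
          rw [Finset.sum_add_distrib, ← Finset.mul_sum, ← Finset.mul_sum, hm.sum_mul_sqNormSum]
          nlinarith
  rw [h1, h2]
  have h8 : 3 / 2 * (γ / (d * H ^ 2)) * ∑ l, q l * (A l - 2 * b * sqNormSum φ p l) ^ 2 ≤
      6 * (γ / (d * H)) * sqNormSum φ p c + 24 * b ^ 2 * (d * H) := by
    calc _ ≤ 3 / 2 * (γ / (d * H ^ 2)) *
          (4 * (H * sqNormSum φ p c) + 16 * b ^ 2 * (d * H ^ 2 / γ) * (d * H)) := by gcongr
      _ = _ := by
          field_simp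
          ring
  have h9 : b ^ 2 * (d * H) ≤ 1 / 2 * b * (d * H) := by
    have : 0 ≤ (d : ℝ) * H := by positivity
    refine mul_le_mul_of_nonneg_right ?_ this
    nlinarith
  nlinarith [mul_le_mul_of_nonneg_left h3 hb0]

theorem mul_sqNormSum_le (hm : IsMixture φ γ p q) (hd : 0 < d) (hH : 0 < H) (hγ : 0 < γ) (l : ι) :
    γ / (d * H) * sqNormSum φ p l ≤ H := by
  have hd' : (0 : ℝ) < d := Nat.cast_pos.2 hd
  have hH' : (0 : ℝ) < H := Nat.cast_pos.2 hH
  calc _ ≤ γ / (d * H) * (d * H ^ 2 / γ) := by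
        gcongr
        exact hm.sqNormSum_le l
    _ = H := by field_simp

theorem abs_deviation_le (hm : IsMixture φ γ p q) (hd : 0 < d) (hH : 0 < H) (hγ : 0 < γ)
    (hγ' : γ ≤ 1 / 2) {V : ι → ℝ} (hV : ∀ l, |V l| ≤ H) (i j : ι) {y : Fin H → ℝ}
    (hy : ∀ h, |y h| ≤ 1) : |deviation φ γ p q V i j y| ≤ 10 * (d * H ^ 2 / γ) := by
  have hd' : (1 : ℝ) ≤ d := Nat.one_le_cast.2 hd
  have hH' : (1 : ℝ) ≤ H := Nat.one_le_cast.2 hH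
  have h1 : (H : ℝ) ≤ d * H ^ 2 / γ := by
    rw [le_div_iff₀ hγ]
    nlinarith [mul_le_mul hd' hH' zero_le_one (by linarith)]
  have h2 := abs_le.1 (abs_sum_mul_le (fun h => hm.abs_diffCoeff_le i j h) hy)
  have h3 : (H : ℝ) * (2 * (d * H / γ)) = 2 * (d * H ^ 2 / γ) := by ring
  rw [h3] at h2
  have h4 := hm.mul_sqNormSum_le hd hH hγ j
  have h5 : 0 ≤ γ / (d * H) * sqNormSum φ p j :=
    mul_nonneg (by positivity) (hm.sqNormSum_nonneg j)
  have hi := abs_le.1 (hV i)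
  have hj := abs_le.1 (hV j)
  rw [deviation, mul_assoc, abs_le]
  constructor <;> linarith [h2.1, h2.2, hi.1, hi.2, hj.1, hj.2]

theorem deviation_sq_le {V : ι → ℝ} (hV : ∀ l, |V l| ≤ H) (i j : ι) {y : Fin H → ℝ}
    (hy : ∀ h, |y h| ≤ 1) : deviation φ γ p q V i j y ^ 2 ≤ deviationSq φ γ p q i j := by
  have h1 := sq_sum_mul_le (diffCoeff φ p q i j) y hy
  have h2 : (V j - V i) ^ 2 ≤ 4 * (H : ℝ) ^ 2 := by
    have hi := abs_le.1 (hV i)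
    have hj := abs_le.1 (hV j)
    nlinarith [hi.1, hi.2, hj.1, hj.2]
  rw [deviation, deviationSq, mul_assoc]
  set A := V j - V i
  set B := ∑ h, diffCoeff φ p q i j h * y h
  set D := γ / (d * H) * sqNormSum φ p j
  nlinarith [sq_nonneg (A - B), sq_nonneg (A - 6 * D), sq_nonneg (B - 6 * D)]

theorem exp_deviation_le (hm : IsMixture φ γ p q) (hd : 0 < d) (hH : 0 < H) (hγ : 0 < γ)
    (hγ' : γ ≤ 1 / 2) {V : ι → ℝ} (hV : ∀ l, |V l| ≤ H) (i j : ι) {y : Fin H → ℝ}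
    (hy : ∀ h, |y h| ≤ 1) {r : ℝ} (hr0 : 0 ≤ r) (hr : r * (10 * (d * H ^ 2 / γ)) ≤ 1) :
    Real.exp (r * deviation φ γ p q V i j y) ≤
      1 + r * deviation φ γ p q V i j y + r ^ 2 * deviationSq φ γ p q i j := by
  have h1 : |r * deviation φ γ p q V i j y| ≤ 1 := by
    rw [abs_mul, abs_of_nonneg hr0]
    exact (mul_le_mul_of_nonneg_left (hm.abs_deviation_le hd hH hγ hγ' hV i j hy) hr0).trans hr
  have h2 := (abs_le.1 (Real.abs_exp_sub_one_sub_id_le h1)).2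
  have h3 := mul_le_mul_of_nonneg_left
    (deviation_sq_le (φ := φ) (γ := γ) (p := p) (q := q) hV i j hy) (sq_nonneg r)
  rw [mul_pow] at h2
  linarith

theorem sum_mul_deviationSq_le (hm : IsMixture φ γ p q) (hd : 0 < d) (hH : 0 < H) (hγ : 0 < γ)
    (hγ' : γ ≤ 1 / 2) (i : ι) :
    ∑ j, p j * deviationSq φ γ p q i j ≤ 6 * H * sqNormSum φ p i + 132 * (d * H ^ 2) := by
  have hd' : (1 : ℝ) ≤ d := Nat.one_le_cast.2 hd
  have hH' : (1 : ℝ) ≤ H := Nat.one_le_cast.2 hH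
  have h1 := hm.sum_mul_sum_diffCoeff_sq_le hγ hγ' i
  have h2 : ∑ j, p j * (γ / (d * H) * sqNormSum φ p j) ^ 2 ≤ γ * H := by
    calc _ ≤ ∑ j, H * (γ / (d * H)) * (p j * sqNormSum φ p j) := by
          refine Finset.sum_le_sum fun j _ => ?_
          have h3 : 0 ≤ γ / (d * H) * sqNormSum φ p j :=
            mul_nonneg (by positivity) (hm.sqNormSum_nonneg j)
          have h4 := mul_le_mul_of_nonneg_right (hm.mul_sqNormSum_le hd hH hγ j) h3
          calc _ ≤ p j * (H * (γ / (d * H) * sqNormSum φ p j)) := by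
                rw [sq]
                exact mul_le_mul_of_nonneg_left h4 (hm.mem_p.1 j)
            _ = _ := by ring
      _ = γ * H := by
          rw [← Finset.mul_sum, hm.sum_mul_sqNormSum]
          field_simp
  have h5 : ∑ j, p j * deviationSq φ γ p q i j = 12 * (H : ℝ) ^ 2 +
      3 * H * ∑ j, p j * ∑ h, diffCoeff φ p q i j h ^ 2 +
      108 * ∑ j, p j * (γ / (d * H) * sqNormSum φ p j) ^ 2 := by
    have : (12 * (H : ℝ) ^ 2) = ∑ j, p j * (12 * (H : ℝ) ^ 2) := by
      rw [← Finset.sum_mul, hm.mem_p.2, one_mul]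
    rw [this, Finset.mul_sum, Finset.mul_sum, ← Finset.sum_add_distrib, ← Finset.sum_add_distrib]
    refine Finset.sum_congr rfl fun j _ => ?_
    rw [deviationSq]
    ring
  have h6 : (H : ℝ) ^ 2 ≤ d * H ^ 2 := by nlinarith [sq_nonneg (H : ℝ)]
  have h7 : γ * H ≤ 1 / 2 * H ^ 2 := by nlinarith
  rw [h5]
  nlinarith [mul_le_mul_of_nonneg_left h1 (by positivity : (0 : ℝ) ≤ 3 * H)]

/-- The mean of the deviation over the selected policy, the losses being replaced by their
expectations. The exploration costs `2 γ H`, the second-order term `6 γ`, and the inaccuracy of the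
feature estimates the terms with `ε`. -/
theorem sum_mul_deviation_le (hm : IsMixture φ γ p q) (hd : 0 < d) (hH : 0 < H) (hγ : 0 < γ)
    (hγ' : γ ≤ 1 / 2) {ψ : ι → Fin H → EuclideanSpace ℝ (Fin d)} {ε : ℝ}
    (hφ : ∀ l h, ‖φ l h - ψ l h‖ ≤ ε / √(d : ℝ)) {θ : Fin H → EuclideanSpace ℝ (Fin d)}
    (hθ : ∀ h, ‖θ h‖ ≤ √(d : ℝ)) (hV : ∀ l, |∑ h, inner ℝ (ψ l h) (θ h)| ≤ H) (i : ι) :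
    ∑ j, p j * deviation φ γ p q (fun l => ∑ h, inner ℝ (ψ l h) (θ h)) i j
        (fun h => inner ℝ (ψ j h) (θ h)) ≤ 8 * (γ * H) + 4 * (d * H ^ 2 / γ * ε) := by
  have hd' : (1 : ℝ) ≤ d := Nat.one_le_cast.2 hd
  have hH' : (1 : ℝ) ≤ H := Nat.one_le_cast.2 hH
  have hsd : 0 < √(d : ℝ) := Real.sqrt_pos.2 (by linarith)
  have herr : ∀ l h, |inner ℝ (φ l h - ψ l h) (θ h)| ≤ ε := by
    intro l h
    calc _ ≤ ‖φ l h - ψ l h‖ * ‖θ h‖ := abs_real_inner_le_norm _ _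
      _ ≤ ε / √(d : ℝ) * √(d : ℝ) :=
          mul_le_mul (hφ l h) (hθ h) (norm_nonneg _) ((norm_nonneg _).trans (hφ l h))
      _ = ε := div_mul_cancel₀ _ hsd.ne'
  have hε : 0 ≤ ε := (abs_nonneg _).trans (herr i ⟨0, hH⟩)
  set V : ι → ℝ := fun l => ∑ h, inner ℝ (ψ l h) (θ h) with hVdef
  set U : ι → ℝ := fun l => ∑ h, inner ℝ (φ l h) (θ h) with hUdef
  have hUV : ∀ l, |U l - V l| ≤ H * ε := by
    intro l
    rw [hUdef, hVdef, ← Finset.sum_sub_distrib]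
    calc _ ≤ ∑ h, |inner ℝ (φ l h) (θ h) - inner ℝ (ψ l h) (θ h)| :=
          Finset.abs_sum_le_sum_abs _ _
      _ ≤ ∑ _h : Fin H, ε := Finset.sum_le_sum fun h _ => by
          rw [← inner_sub_left]
          exact herr l h
      _ = _ := by rw [Finset.sum_const, Finset.card_univ, Fintype.card_fin, nsmul_eq_mul]
  have h1 : ∑ j, p j * ∑ h, diffCoeff φ p q i j h * inner ℝ (ψ j h) (θ h) ≤
      U i - ∑ l, q l * U l + 2 * (d * H ^ 2 / γ * ε) := by
    rw [← hm.sum_mul_sum_diffCoeff_mul_inner i θ]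
    have h2 : ∀ j, ∑ h, diffCoeff φ p q i j h * inner ℝ (ψ j h) (θ h) ≤
        ∑ h, diffCoeff φ p q i j h * inner ℝ (φ j h) (θ h) + 2 * (d * H ^ 2 / γ * ε) := by
      intro j
      calc _ ≤ ∑ h, (diffCoeff φ p q i j h * inner ℝ (φ j h) (θ h) +
            2 * (d * H / γ) * ε) := by
            refine Finset.sum_le_sum fun h _ => ?_
            have h3 : |diffCoeff φ p q i j h * inner ℝ (φ j h - ψ j h) (θ h)| ≤
                2 * (d * H / γ) * ε := by
              rw [abs_mul]
              exact mul_le_mul (hm.abs_diffCoeff_le i j h) (herr j h) (abs_nonneg _)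
                (by positivity)
            have h4 := (abs_le.1 h3).1
            rw [inner_sub_left, mul_sub] at h4
            linarith
        _ = _ := by
            rw [Finset.sum_add_distrib, Finset.sum_const, Finset.card_univ, Fintype.card_fin,
              nsmul_eq_mul]
            ring
    calc _ ≤ ∑ j, p j * (∑ h, diffCoeff φ p q i j h * inner ℝ (φ j h) (θ h) +
          2 * (d * H ^ 2 / γ * ε)) :=
          Finset.sum_le_sum fun j _ => mul_le_mul_of_nonneg_left (h2 j) (hm.mem_p.1 j)
      _ = _ := by
          simp only [mul_add]
          rw [Finset.sum_add_distrib, ← Finset.sum_mul, hm.mem_p.2, one_mul]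
  have h5 : ∑ l, q l * V l - H * ε ≤ ∑ l, q l * U l := by
    have : H * ε = ∑ l, q l * (H * ε) := by rw [← Finset.sum_mul, hm.mem_q.2, one_mul]
    rw [this, ← Finset.sum_sub_distrib]
    refine Finset.sum_le_sum fun l _ => ?_
    rw [← mul_sub]
    exact mul_le_mul_of_nonneg_left (by linarith [(abs_le.1 (hUV l)).1]) (hm.mem_q.1 l)
  have h6 := hm.sum_sub_mul_le hγ hV
  have h7 := (abs_le.1 (hUV i)).2
  have h8 : (H : ℝ) * ε ≤ d * H ^ 2 / γ * ε := by
    refine mul_le_mul_of_nonneg_right ?_ hε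
    rw [le_div_iff₀ hγ]
    nlinarith [mul_le_mul hd' hH' zero_le_one (by linarith)]
  have h9 : ∑ j, p j * deviation φ γ p q V i j (fun h => inner ℝ (ψ j h) (θ h)) =
      ∑ j, p j * V j - V i +
        ∑ j, p j * ∑ h, diffCoeff φ p q i j h * inner ℝ (ψ j h) (θ h) + 6 * γ := by
    have h10 : V i = ∑ j, p j * V i := by rw [← Finset.sum_mul, hm.mem_p.2, one_mul]
    have h11 : 6 * γ = 6 * (γ / (d * H)) * ∑ j, p j * sqNormSum φ p j := by
      rw [hm.sum_mul_sqNormSum]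
      field_simp
    rw [h10, h11, Finset.mul_sum, ← Finset.sum_sub_distrib, ← Finset.sum_add_distrib,
      ← Finset.sum_add_distrib]
    refine Finset.sum_congr rfl fun j _ => ?_
    rw [deviation]
    ring
  rw [h9]
  nlinarith

/-- The bound for the exponential moment of the deviation. The variance term is proportional to the
squared norm `s` of policy `i`, and for `3 H r ≤ b` it is compensated by the bonus `2 b s`. -/
theorem sum_mul_one_add_deviation_le (hm : IsMixture φ γ p q) (hd : 0 < d) (hH : 0 < H)
    (hγ : 0 < γ) (hγ' : γ ≤ 1 / 2) {ψ : ι → Fin H → EuclideanSpace ℝ (Fin d)} {ε : ℝ}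
    (hφ : ∀ l h, ‖φ l h - ψ l h‖ ≤ ε / √(d : ℝ)) {θ : Fin H → EuclideanSpace ℝ (Fin d)}
    (hθ : ∀ h, ‖θ h‖ ≤ √(d : ℝ)) (hV : ∀ l, |∑ h, inner ℝ (ψ l h) (θ h)| ≤ H) (i : ι)
    {r b : ℝ} (hr0 : 0 ≤ r) (hr : 3 * H * r ≤ b) :
    ∑ j, p j * (1 + r * deviation φ γ p q (fun l => ∑ h, inner ℝ (ψ l h) (θ h)) i j
        (fun h => inner ℝ (ψ j h) (θ h)) + r ^ 2 * deviationSq φ γ p q i j) ≤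
      Real.exp (r * (2 * b * sqNormSum φ p i +
        (8 * (γ * H) + 4 * (d * H ^ 2 / γ * ε) + 44 * b * (d * H)))) := by
  have h1 := hm.sum_mul_deviation_le hd hH hγ hγ' hφ hθ hV i
  have h2 := hm.sum_mul_deviationSq_le hd hH hγ hγ' i
  have h3 := hm.sqNormSum_nonneg i
  set X : ι → ℝ := fun j => deviation φ γ p q (fun l => ∑ h, inner ℝ (ψ l h) (θ h)) i j
        (fun h => inner ℝ (ψ j h) (θ h))
  have h4 : ∑ j, p j * (1 + r * X j + r ^ 2 * deviationSq φ γ p q i j) =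
      r * (∑ j, p j * X j + r * ∑ j, p j * deviationSq φ γ p q i j) + 1 := by
    calc _ = ∑ j, (p j + r * (p j * X j + r * (p j * deviationSq φ γ p q i j))) :=
          Finset.sum_congr rfl fun j _ => by ring
      _ = _ := by
          rw [Finset.sum_add_distrib, hm.mem_p.2, ← Finset.mul_sum, Finset.sum_add_distrib,
            ← Finset.mul_sum, add_comm]
  rw [h4]
  refine le_trans ?_ (Real.add_one_le_exp _)
  have h5 : r * ∑ j, p j * deviationSq φ γ p q i j ≤
      2 * b * sqNormSum φ p i + 44 * b * (d * H) := by
    calc _ ≤ r * (6 * H * sqNormSum φ p i + 132 * (d * H ^ 2)) := by gcongr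
      _ = 2 * (3 * H * r) * sqNormSum φ p i + 44 * (3 * H * r) * (d * H) := by ring
      _ ≤ _ := by gcongr
  have h6 := mul_le_mul_of_nonneg_left (add_le_add h1 h5) hr0
  linarith

end IsMixture

end Estimates

/-! ### Linearity of the value -/

section MDP

variable {S A : Type*} [MeasurableSpace S] [MeasurableSpace A] {d H : ℕ}

/-- The features of a linear MDP cannot be zero-dimensional, since the total masses of the transition
kernels are linear in them. -/
theorem LinearMDP.dim_pos [NeZero H] (M : LinearMDP S A d H) (π : Policy S A H) : 0 < d := by
  rcases Nat.eq_zero_or_pos d with rfl | h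
  · exfalso
    have := M.isProb_init
    have := π.isMarkov 0
    have := M.isMarkov_trans 0
    obtain ⟨s⟩ := nonempty_of_isProbabilityMeasure M.init
    obtain ⟨a⟩ := nonempty_of_isProbabilityMeasure (π.kernel 0 s)
    obtain ⟨ν, -, hν⟩ := M.trans_linear 0
    have h1 := hν (s, a) Set.univ MeasurableSet.univ
    rw [probReal_univ, Subsingleton.elim (M.feat (s, a)) 0, inner_zero_left] at h1
    exact one_ne_zero h1
  · exact h

theorem LinearMDP.integrable_feat [NeZero H] (M : LinearMDP S A d H) (π : Policy S A H)
    (h : Fin H) : Integrable (fun τ => M.feat (τ h)) (M.law π) :=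
  Integrable.of_bound (M.measurable_feat.comp (measurable_pi_apply h)).aestronglyMeasurable 1
    (ae_of_all _ fun _ => M.norm_feat_le _)

theorem LinearMDP.integral_loss [NeZero H] (M : LinearMDP S A d H) (π : Policy S A H)
    (h : Fin H) (θ : EuclideanSpace ℝ (Fin d)) :
    ∫ τ, M.loss θ (τ h) ∂(M.law π) = inner ℝ (M.visitation π h) θ := by
  simp only [LinearMDP.loss, real_inner_comm θ]
  exact integral_inner (M.integrable_feat π h) θ

theorem LinearMDP.value_eq [NeZero H] (M : LinearMDP S A d H) (π : Policy S A H)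
    (θ : Fin H → EuclideanSpace ℝ (Fin d)) :
    M.value θ π = ∑ h, inner ℝ (M.visitation π h) (θ h) := by
  rw [LinearMDP.value, integral_finsetSum]
  · exact Finset.sum_congr rfl fun h _ => M.integral_loss π h _
  · intro h _
    exact (M.integrable_feat π h).inner_const (θ h)

theorem LinearMDP.abs_value_le [NeZero H] (M : LinearMDP S A d H) (π : Policy S A H)
    {θ : Fin H → EuclideanSpace ℝ (Fin d)} (hθ : M.Admissible θ) : |M.value θ π| ≤ H := by
  have h := norm_integral_le_of_norm_le_const (μ := M.law π)
    (f := fun τ => ∑ h, M.loss (θ h) (τ h)) (C := H) (ae_of_all _ fun τ => by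
      calc _ ≤ ∑ h, |M.loss (θ h) (τ h)| := Finset.abs_sum_le_sum_abs _ _
        _ ≤ ∑ _h : Fin H, (1 : ℝ) := Finset.sum_le_sum fun h _ => hθ.2 h _
        _ = H := by simp)
  rwa [probReal_univ, mul_one] at h

end MDP

/-! ### Conditional laws -/

section CondLaw

variable {Ω E : Type*} [MeasurableSpace E] {m mΩ : MeasurableSpace Ω} {P : Measure Ω}
  [IsProbabilityMeasure P] {D : Set Ω} {T : Ω → E} {ν : Measure E} [IsProbabilityMeasure ν]
  {ρ : Ω → ℝ}

/-- If, conditionally on `m`, the event `D` has probability `ρ` and `T` has law `ν` on it, then the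
conditional expectation of a function of `T` on `D` is `ρ` times the mean with respect to `ν`. -/
theorem condExp_indicator_comp (hm : m ≤ mΩ) (hD : MeasurableSet D) (hT : Measurable T)
    (hρm : Measurable[m] ρ) (hρ0 : ∀ ω, 0 ≤ ρ ω) (hρ : Integrable ρ P)
    (h : ∀ B, MeasurableSet B → P⟦D ∩ T ⁻¹' B | m⟧ =ᵐ[P] fun ω => ρ ω * ν.real B) {f : E → ℝ}
    (hf : Measurable f) {C : ℝ} (hC : ∀ x, |f x| ≤ C) :
    P[D.indicator (f ∘ T) | m] =ᵐ[P] fun ω => ρ ω * ∫ x, f x ∂ν := by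
  have hfT : Integrable (D.indicator (f ∘ T)) P :=
    (Integrable.of_bound (hf.comp hT).aestronglyMeasurable C
      (ae_of_all _ fun _ => hC _)).indicator hD
  refine (ae_eq_condExp_of_forall_setIntegral_eq hm hfT
    (fun s _ _ => (hρ.mul_const _).integrableOn) (fun s hs _ => ?_)
    (hρm.mul_const _).aestronglyMeasurable).symm
  have hmap : (P.restrict (s ∩ D)).map T = ENNReal.ofReal (∫ ω in s, ρ ω ∂P) • ν := by
    ext B hB
    have hBT : MeasurableSet (D ∩ T ⁻¹' B) := hD.inter (hT hB)
    have h1 : ∫ ω in s, (D ∩ T ⁻¹' B).indicator (fun _ => (1 : ℝ)) ω ∂P =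
        (∫ ω in s, ρ ω ∂P) * ν.real B := by
      rw [← setIntegral_condExp hm ((integrable_const _).indicator hBT) hs,
        ← integral_mul_const]
      exact integral_congr_ae (ae_restrict_of_ae (h B hB))
    rw [integral_indicator_const _ hBT, smul_eq_mul, mul_one,
      measureReal_restrict_apply hBT] at h1
    have h2 : T ⁻¹' B ∩ (s ∩ D) = D ∩ T ⁻¹' B ∩ s := by
      ext
      simp only [Set.mem_inter_iff]
      tauto
    rw [Measure.map_apply hT hB, Measure.restrict_apply (hT hB), h2, Measure.smul_apply,
      smul_eq_mul, ← ofReal_measureReal, h1,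
      ENNReal.ofReal_mul (integral_nonneg fun ω => hρ0 ω), ofReal_measureReal]
  rw [integral_mul_const, setIntegral_indicator hD]
  have h3 : ∫ ω in s ∩ D, (f ∘ T) ω ∂P = ∫ x, f x ∂((P.restrict (s ∩ D)).map T) :=
    (integral_map hT.aemeasurable hf.aestronglyMeasurable).symm
  rw [h3, hmap, integral_smul_measure, ENNReal.toReal_ofReal (integral_nonneg fun ω => hρ0 ω),
    smul_eq_mul]

theorem setIntegral_mul_comp (hm : m ≤ mΩ) (hD : MeasurableSet D) (hT : Measurable T)
    (hρm : Measurable[m] ρ) (hρ0 : ∀ ω, 0 ≤ ρ ω) (hρ : Integrable ρ P)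
    (h : ∀ B, MeasurableSet B → P⟦D ∩ T ⁻¹' B | m⟧ =ᵐ[P] fun ω => ρ ω * ν.real B) {f : E → ℝ}
    (hf : Measurable f) {C : ℝ} (hC : ∀ x, |f x| ≤ C) {G : Ω → ℝ} (hG : Measurable[m] G) {C' : ℝ}
    (hC' : ∀ ω, |G ω| ≤ C') :
    ∫ ω in D, G ω * f (T ω) ∂P = ∫ ω, ρ ω * (G ω * ∫ x, f x ∂ν) ∂P := by
  have hfT : Integrable (D.indicator (f ∘ T)) P :=
    (Integrable.of_bound (hf.comp hT).aestronglyMeasurable C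
      (ae_of_all _ fun _ => hC _)).indicator hD
  have hGf : Integrable (G * D.indicator (f ∘ T)) P :=
    hfT.bdd_mul (hG.mono hm le_rfl).aestronglyMeasurable (ae_of_all _ hC')
  have h1 := condExp_mul_of_stronglyMeasurable_left hG.stronglyMeasurable hGf hfT
  have h2 := condExp_indicator_comp hm hD hT hρm hρ0 hρ h hf hC
  rw [← integral_indicator hD]
  calc _ = ∫ ω, (G * D.indicator (f ∘ T)) ω ∂P := by
        congr 1
        ext ω
        by_cases hω : ω ∈ D <;> simp [hω]
    _ = ∫ ω, (P[G * D.indicator (f ∘ T) | m]) ω ∂P := (integral_condExp hm).symm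
    _ = _ := by
        refine integral_congr_ae ?_
        filter_upwards [h1, h2] with ω h1 h2
        rw [h1, Pi.mul_apply, h2]
        ring

end CondLaw

/-! ### Bounded measurable functions -/

section BddMeasurable

variable {Ω : Type*} {m : MeasurableSpace Ω} {f g : Ω → ℝ}

/-- `f` is measurable with respect to the σ-algebra `m`, and bounded. -/
def IsBddMeasurable (m : MeasurableSpace Ω) (f : Ω → ℝ) : Prop :=
  Measurable[m] f ∧ ∃ C, ∀ ω, |f ω| ≤ C

namespace IsBddMeasurable

theorem const (a : ℝ) : IsBddMeasurable m fun _ => a :=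
  ⟨measurable_const, |a|, fun _ => le_rfl⟩

theorem mono {m' : MeasurableSpace Ω} (hf : IsBddMeasurable m f) (h : m ≤ m') :
    IsBddMeasurable m' f :=
  ⟨hf.1.mono h le_rfl, hf.2⟩

theorem add (hf : IsBddMeasurable m f) (hg : IsBddMeasurable m g) :
    IsBddMeasurable m fun ω => f ω + g ω := by
  obtain ⟨hf, C, hC⟩ := hf
  obtain ⟨hg, C', hC'⟩ := hg
  exact ⟨hf.add hg, C + C', fun ω => (abs_add_le _ _).trans (add_le_add (hC ω) (hC' ω))⟩

theorem mul (hf : IsBddMeasurable m f) (hg : IsBddMeasurable m g) :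
    IsBddMeasurable m fun ω => f ω * g ω := by
  obtain ⟨hf, C, hC⟩ := hf
  obtain ⟨hg, C', hC'⟩ := hg
  refine ⟨hf.mul hg, C * C', fun ω => ?_⟩
  rw [abs_mul]
  exact mul_le_mul (hC ω) (hC' ω) (abs_nonneg _) ((abs_nonneg _).trans (hC ω))

theorem sub (hf : IsBddMeasurable m f) (hg : IsBddMeasurable m g) :
    IsBddMeasurable m fun ω => f ω - g ω := by
  simpa [sub_eq_add_neg] using hf.add ((const (-1)).mul hg)

theorem sum {κ : Type*} {s : Finset κ} {f : κ → Ω → ℝ} (hf : ∀ a ∈ s, IsBddMeasurable m (f a)) :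
    IsBddMeasurable m fun ω => ∑ a ∈ s, f a ω := by
  classical
  induction s using Finset.induction_on with
  | empty => simpa using const 0
  | insert a s ha ih =>
    simp only [Finset.sum_insert ha]
    exact (hf a (Finset.mem_insert_self a s)).add
      (ih fun b hb => hf b (Finset.mem_insert_of_mem hb))

theorem sq (hf : IsBddMeasurable m f) : IsBddMeasurable m fun ω => f ω ^ 2 := by
  simpa [pow_two] using hf.mul hf

theorem exp (hf : IsBddMeasurable m f) : IsBddMeasurable m fun ω => Real.exp (f ω) := by
  obtain ⟨hf, C, hC⟩ := hf
  refine ⟨Real.measurable_exp.comp hf, Real.exp C, fun ω => ?_⟩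
  rw [abs_of_pos (Real.exp_pos _)]
  exact Real.exp_le_exp.2 ((le_abs_self _).trans (hC ω))

theorem select {κ : Type*} [Fintype κ] {c : Ω → κ} (hc : ∀ a, MeasurableSet[m] (c ⁻¹' {a}))
    {f : κ → Ω → ℝ} (hf : ∀ a, IsBddMeasurable m (f a)) :
    IsBddMeasurable m fun ω => f (c ω) ω := by
  classical
  have h : (fun ω => f (c ω) ω) =
      fun ω => ∑ a, (c ⁻¹' {a}).indicator (fun _ => (1 : ℝ)) ω * f a ω := by
    ext ω
    rw [Finset.sum_eq_single (c ω)]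
    · simp
    · intro a _ ha
      simp [Ne.symm ha]
    · simp
  rw [h]
  refine sum fun a _ => mul ⟨measurable_const.indicator (hc a), 1, fun ω => ?_⟩ (hf a)
  by_cases hω : ω ∈ c ⁻¹' {a} <;> simp [hω]

theorem integrable {mΩ : MeasurableSpace Ω} {P : Measure Ω} [IsFiniteMeasure P]
    (hf : IsBddMeasurable mΩ f) : Integrable f P := by
  obtain ⟨hf, C, hC⟩ := hf
  exact Integrable.of_bound hf.aestronglyMeasurable C (ae_of_all _ hC)

end IsBddMeasurable

theorem measurable_select {κ : Type*} [Fintype κ] {c : Ω → κ}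
    (hc : ∀ a, MeasurableSet[m] (c ⁻¹' {a})) {f : κ → Ω → ℝ} (hf : ∀ a, Measurable[m] (f a)) :
    Measurable[m] fun ω => f (c ω) ω := by
  classical
  have h : (fun ω => f (c ω) ω) = fun ω => ∑ a, (c ⁻¹' {a}).indicator (f a) ω := by
    ext ω
    rw [Finset.sum_eq_single (c ω)]
    · simp
    · intro a _ ha
      simp [Ne.symm ha]
    · simp
  rw [h]
  exact Finset.measurable_sum _ fun a _ => (hf a).indicator (hc a)

end BddMeasurable

/-! ### Measurability of the algorithm -/

section Measurability

variable {Ω ι : Type*} [Fintype ι] {d H : ℕ}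

theorem measurable_invInner_covMatrix (φ : ι → Fin H → EuclideanSpace ℝ (Fin d)) (h : Fin H)
    (u v : EuclideanSpace ℝ (Fin d)) : Measurable fun p => invInner (covMatrix φ p h) u v := by
  have hc := continuous_designMatrix fun i => φ i h
  have h1 : (fun p => invInner (covMatrix φ p h) u v) = fun p =>
      (designMatrix (fun i => φ i h) p).det⁻¹ *
        (u.ofLp ⬝ᵥ ((designMatrix (fun i => φ i h) p).adjugate *ᵥ v.ofLp)) := by
    ext p
    rw [invInner, covMatrix, Matrix.inv_def, Ring.inverse_eq_inv', Matrix.smul_mulVec,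
      dotProduct_smul, smul_eq_mul]
  rw [h1]
  refine hc.matrix_det.measurable.inv.mul (Continuous.measurable ?_)
  exact continuous_const.dotProduct (hc.matrix_adjugate.matrix_mulVec continuous_const)

theorem measurable_selectProb {m : MeasurableSpace Ω} {w : Ω → ι → ℝ} (hw : Measurable[m] w)
    (γ : ℝ) (g : Fin H → ι → ℝ) : Measurable[m] fun ω => selectProb γ g (w ω) := by
  unfold selectProb
  fun_prop

theorem measurable_normWeight {m : MeasurableSpace Ω} {w : Ω → ι → ℝ} (hw : Measurable[m] w) :
    Measurable[m] fun ω => normWeight (w ω) := by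
  unfold normWeight
  fun_prop

theorem measurable_weight {m : MeasurableSpace Ω} (φ : ι → Fin H → EuclideanSpace ℝ (Fin d))
    (g : Fin H → ι → ℝ) (γ δ : ℝ) (K : ℕ) {c : ℕ → Ω → ι} {y : ℕ → Ω → Fin H → ℝ} {n : ℕ}
    (hc : ∀ k < n, ∀ i, MeasurableSet[m] (c k ⁻¹' {i})) (hy : ∀ k < n, Measurable[m] (y k)) :
    Measurable[m] fun ω => weight φ g γ δ K (fun j => c j ω) (fun j => y j ω) n := by
  induction n with
  | zero =>
    unfold weight
    exact measurable_const
  | succ n ih =>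
    have hw := ih (fun k hk => hc k (hk.trans n.lt_succ_self))
      fun k hk => hy k (hk.trans n.lt_succ_self)
    have hp := measurable_selectProb hw γ g
    refine measurable_pi_lambda _ fun l => ?_
    simp only [weight, optValue_eq, sqNormSum]
    refine ((measurable_pi_apply l).comp hw).mul (Real.measurable_exp.comp
      (measurable_const.mul (Measurable.sub ?_ (measurable_const.mul ?_))))
    · refine Finset.measurable_sum _ fun h _ => Measurable.mul ?_
        ((measurable_pi_apply h).comp (hy n n.lt_succ_self))
      exact measurable_select (hc n n.lt_succ_self)
        (f := fun j ω => invInner (covMatrix φ (selectProb γ g (weight φ g γ δ K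
          (fun j => c j ω) (fun j => y j ω) n)) h) (φ l h) (φ j h))
        fun j => (measurable_invInner_covMatrix φ h _ _).comp hp
    · exact Finset.measurable_sum _ fun h _ =>
        (measurable_invInner_covMatrix φ h (φ l h) (φ l h)).comp hp

theorem weight_pos (φ : ι → Fin H → EuclideanSpace ℝ (Fin d)) (g : Fin H → ι → ℝ) (γ δ : ℝ)
    (K : ℕ) (c : ℕ → ι) (y : ℕ → Fin H → ℝ) (k : ℕ) (l : ι) : 0 < weight φ g γ δ K c y k l := by
  induction k generalizing l with
  | zero => exact one_pos
  | succ k ih => exact mul_pos (ih l) (Real.exp_pos _)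

end Measurability

/-! ### The exponential supermartingale -/

section Step

variable {S A ι Ω : Type*} [MeasurableSpace S] [MeasurableSpace A] [Fintype ι] {d H : ℕ}
  {m mΩ : MeasurableSpace Ω} {φ : ι → Fin H → EuclideanSpace ℝ (Fin d)} {γ : ℝ}
  {p q : Ω → ι → ℝ} {θ : Ω → Fin H → EuclideanSpace ℝ (Fin d)}

theorem isBddMeasurable_prob (hp : Measurable[m] p) (hmix : ∀ ω, IsMixture φ γ (p ω) (q ω))
    (l : ι) : IsBddMeasurable m fun ω => p ω l := by
  refine ⟨(measurable_pi_apply l).comp hp, 1, fun ω => ?_⟩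
  have h := (hmix ω).mem_p
  rw [abs_of_nonneg (h.1 l), ← h.2]
  exact Finset.single_le_sum (fun j _ => h.1 j) (Finset.mem_univ l)

theorem isBddMeasurable_norm (hq : Measurable[m] q) (hmix : ∀ ω, IsMixture φ γ (p ω) (q ω))
    (l : ι) : IsBddMeasurable m fun ω => q ω l := by
  refine ⟨(measurable_pi_apply l).comp hq, 1, fun ω => ?_⟩
  have h := (hmix ω).mem_q
  rw [abs_of_nonneg (h.1 l), ← h.2]
  exact Finset.single_le_sum (fun j _ => h.1 j) (Finset.mem_univ l)

theorem isBddMeasurable_invInner (hp : Measurable[m] p)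
    (hmix : ∀ ω, IsMixture φ γ (p ω) (q ω)) (l j : ι) (h : Fin H) :
    IsBddMeasurable m fun ω => invInner (covMatrix φ (p ω) h) (φ l h) (φ j h) :=
  ⟨(measurable_invInner_covMatrix φ h _ _).comp hp, _, fun ω => (hmix ω).abs_invInner_le l j h⟩

theorem isBddMeasurable_sqNormSum (hp : Measurable[m] p)
    (hmix : ∀ ω, IsMixture φ γ (p ω) (q ω)) (l : ι) :
    IsBddMeasurable m fun ω => sqNormSum φ (p ω) l :=
  .sum fun h _ => isBddMeasurable_invInner hp hmix l l h

theorem isBddMeasurable_diffCoeff (hp : Measurable[m] p) (hq : Measurable[m] q)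
    (hmix : ∀ ω, IsMixture φ γ (p ω) (q ω)) (i j : ι) (h : Fin H) :
    IsBddMeasurable m fun ω => diffCoeff φ (p ω) (q ω) i j h :=
  (isBddMeasurable_invInner hp hmix i j h).sub
    (.sum fun l _ => (isBddMeasurable_norm hq hmix l).mul (isBddMeasurable_invInner hp hmix l j h))

theorem isBddMeasurable_deviation (hp : Measurable[m] p) (hq : Measurable[m] q)
    (hmix : ∀ ω, IsMixture φ γ (p ω) (q ω)) {V : Ω → ι → ℝ}
    (hV : ∀ l, IsBddMeasurable m fun ω => V ω l) {y : Ω → Fin H → ℝ}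
    (hy : ∀ h, IsBddMeasurable m fun ω => y ω h) (i j : ι) :
    IsBddMeasurable m fun ω => deviation φ γ (p ω) (q ω) (V ω) i j (y ω) :=
  (((hV j).sub (hV i)).add
    (.sum fun h _ => (isBddMeasurable_diffCoeff hp hq hmix i j h).mul (hy h))).add
    ((IsBddMeasurable.const _).mul (isBddMeasurable_sqNormSum hp hmix j))

theorem isBddMeasurable_deviationSq (hp : Measurable[m] p) (hq : Measurable[m] q)
    (hmix : ∀ ω, IsMixture φ γ (p ω) (q ω)) (i j : ι) :
    IsBddMeasurable m fun ω => deviationSq φ γ (p ω) (q ω) i j :=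
  (IsBddMeasurable.const _).mul
    (((IsBddMeasurable.const _).add ((IsBddMeasurable.const _).mul
      (.sum fun h _ => (isBddMeasurable_diffCoeff hp hq hmix i j h).sq))).add
    ((IsBddMeasurable.const _).mul
      ((IsBddMeasurable.const _).mul (isBddMeasurable_sqNormSum hp hmix j)).sq))

variable {M : LinearMDP S A d H}

theorem isBddMeasurable_theta (hθ : Measurable[m] θ) (hadm : ∀ ω, M.Admissible (θ ω)) (h : Fin H)
    (a : Fin d) : IsBddMeasurable m fun ω => θ ω h a := by
  refine ⟨?_, √(d : ℝ), fun ω => ?_⟩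
  · exact (EuclideanSpace.proj (𝕜 := ℝ) a).continuous.measurable.comp
      ((measurable_pi_apply h).comp hθ)
  · exact (PiLp.norm_apply_le (θ ω h) a).trans ((hadm ω).1 h)

theorem inner_eq_sum_mul (u v : EuclideanSpace ℝ (Fin d)) : inner ℝ u v = ∑ a, v a * u a := by
  rw [PiLp.inner_apply]
  rfl

theorem isBddMeasurable_inner_theta (hθ : Measurable[m] θ) (hadm : ∀ ω, M.Admissible (θ ω))
    (h : Fin H) (u : EuclideanSpace ℝ (Fin d)) : IsBddMeasurable m fun ω => inner ℝ u (θ ω h) := by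
  simp only [inner_eq_sum_mul]
  exact .sum fun a _ => (isBddMeasurable_theta hθ hadm h a).mul (.const _)

theorem measurable_loss {T : Ω → Fin H → S × A} (hθ : Measurable[m] θ) (hT : Measurable[m] T) :
    Measurable[m] fun ω h => M.loss (θ ω h) (T ω h) := by
  refine measurable_pi_lambda _ fun h => ?_
  exact Measurable.inner (M.measurable_feat.comp ((measurable_pi_apply h).comp hT))
    ((measurable_pi_apply h).comp hθ)

theorem isBddMeasurable_loss {T : Ω → Fin H → S × A} (hθ : Measurable[m] θ) (hT : Measurable[m] T)
    (hadm : ∀ ω, M.Admissible (θ ω)) (h : Fin H) :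
    IsBddMeasurable m fun ω => M.loss (θ ω h) (T ω h) :=
  ⟨(measurable_pi_apply h).comp (measurable_loss hθ hT), 1, fun ω => (hadm ω).2 h _⟩

variable [NeZero H] {Pi : ι → Policy S A H} {P : Measure Ω} [IsProbabilityMeasure P]
  {c : Ω → ι} {T : Ω → Fin H → S × A}

theorem isBddMeasurable_value (hθ : Measurable[m] θ) (hadm : ∀ ω, M.Admissible (θ ω))
    (π : Policy S A H) : IsBddMeasurable m fun ω => M.value (θ ω) π := by
  simp only [LinearMDP.value_eq]
  exact .sum fun h _ => isBddMeasurable_inner_theta hθ hadm h _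

/-- On the event that policy `j` is selected, an observed loss may be replaced by `p j` times its
expectation under policy `j`. -/
theorem setIntegral_mul_loss (hm : m ≤ mΩ) (hp : Measurable[m] p)
    (hmix : ∀ ω, IsMixture φ γ (p ω) (q ω)) (hθ : Measurable[m] θ)
    (hadm : ∀ ω, M.Admissible (θ ω)) (hc : ∀ j, MeasurableSet (c ⁻¹' {j})) (hT : Measurable T)
    (hlaw : ∀ j, ∀ B : Set (Fin H → S × A), MeasurableSet B →
      P⟦c ⁻¹' {j} ∩ T ⁻¹' B | m⟧ =ᵐ[P] fun ω => p ω j * (M.law (Pi j)).real B)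
    {G : Ω → ℝ} (hG : IsBddMeasurable m G) (j : ι) (h : Fin H) :
    ∫ ω in c ⁻¹' {j}, G ω * M.loss (θ ω h) (T ω h) ∂P =
      ∫ ω, p ω j * (G ω * inner ℝ (M.visitation (Pi j) h) (θ ω h)) ∂P := by
  have hpj := isBddMeasurable_prob hp hmix j
  have hGθ : ∀ a, IsBddMeasurable m fun ω => G ω * θ ω h a :=
    fun a => hG.mul (isBddMeasurable_theta hθ hadm h a)
  have hf : ∀ a : Fin d, Measurable fun t : Fin H → S × A => M.feat (t h) a := fun a =>
    (EuclideanSpace.proj (𝕜 := ℝ) a).continuous.measurable.comp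
      (M.measurable_feat.comp (measurable_pi_apply h))
  have hf1 : ∀ (a : Fin d) (t : Fin H → S × A), |M.feat (t h) a| ≤ 1 := fun a t =>
    (PiLp.norm_apply_le (M.feat (t h)) a).trans (M.norm_feat_le _)
  have hvis : ∀ a : Fin d, ∫ t, M.feat (t h) a ∂(M.law (Pi j)) = M.visitation (Pi j) h a :=
    fun a => (EuclideanSpace.proj (𝕜 := ℝ) a).integral_comp_comm (M.integrable_feat (Pi j) h)
  have hterm : ∀ a : Fin d, ∫ ω in c ⁻¹' {j}, G ω * θ ω h a * M.feat (T ω h) a ∂P =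
      ∫ ω, p ω j * (G ω * θ ω h a * M.visitation (Pi j) h a) ∂P := by
    intro a
    obtain ⟨hGm, C, hC⟩ := hGθ a
    rw [← hvis a]
    exact setIntegral_mul_comp hm (hc j) hT hpj.1 (fun ω => (hmix ω).mem_p.1 j)
      (hpj.mono hm).integrable (hlaw j) (hf a) (hf1 a) hGm hC
  have hfT : ∀ a : Fin d, IsBddMeasurable mΩ fun ω => M.feat (T ω h) a :=
    fun a => ⟨(hf a).comp hT, 1, fun ω => hf1 a _⟩
  simp only [LinearMDP.loss, inner_eq_sum_mul, Finset.mul_sum, ← mul_assoc]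
  rw [integral_finsetSum, integral_finsetSum]
  · refine Finset.sum_congr rfl fun a _ => ?_
    rw [hterm a]
    simp only [mul_assoc]
  · intro a _
    exact (((hpj.mul hG).mul (isBddMeasurable_theta hθ hadm h a)).mul (.const _)).mono hm
      |>.integrable
  · intro a _
    exact (((hGθ a).mono hm).mul (hfT a)).integrable.integrableOn

theorem setIntegral_eq_integral_prob_mul (hm : m ≤ mΩ) (hp : Measurable[m] p)
    (hmix : ∀ ω, IsMixture φ γ (p ω) (q ω)) (hc : ∀ j, MeasurableSet (c ⁻¹' {j}))
    (hT : Measurable T)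
    (hlaw : ∀ j, ∀ B : Set (Fin H → S × A), MeasurableSet B →
      P⟦c ⁻¹' {j} ∩ T ⁻¹' B | m⟧ =ᵐ[P] fun ω => p ω j * (M.law (Pi j)).real B)
    {G : Ω → ℝ} (hG : IsBddMeasurable m G) (j : ι) :
    ∫ ω in c ⁻¹' {j}, G ω ∂P = ∫ ω, p ω j * G ω ∂P := by
  have hpj := isBddMeasurable_prob hp hmix j
  obtain ⟨hGm, C, hC⟩ := hG
  have h := setIntegral_mul_comp (f := fun _ => 1) (C := 1) hm (hc j) hT hpj.1
    (fun ω => (hmix ω).mem_p.1 j) (hpj.mono hm).integrable (hlaw j) measurable_const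
    (fun _ => by simp) hGm hC
  simpa using h

/-- One step of the exponential supermartingale. The exponential is bounded by a polynomial which
is affine in the observed losses, so that its conditional expectation follows from the conditional
law of the selected policy and of the trajectory. -/
theorem integral_mul_exp_deviation_le (hm : m ≤ mΩ) (hγ : 0 < γ) (hγ' : γ ≤ 1 / 2) {ε : ℝ}
    (hφ : ∀ l h, ‖φ l h - M.visitation (Pi l) h‖ ≤ ε / √(d : ℝ)) (hp : Measurable[m] p)
    (hq : Measurable[m] q) (hmix : ∀ ω, IsMixture φ γ (p ω) (q ω)) (hθ : Measurable[m] θ)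
    (hadm : ∀ ω, M.Admissible (θ ω)) (hc : ∀ j, MeasurableSet (c ⁻¹' {j})) (hT : Measurable T)
    (hlaw : ∀ j, ∀ B : Set (Fin H → S × A), MeasurableSet B →
      P⟦c ⁻¹' {j} ∩ T ⁻¹' B | m⟧ =ᵐ[P] fun ω => p ω j * (M.law (Pi j)).real B)
    {W : Ω → ℝ} (hW : IsBddMeasurable m W) (hW0 : ∀ ω, 0 ≤ W ω) (i : ι) {r b : ℝ} (hr0 : 0 ≤ r)
    (hrb : 3 * H * r ≤ b) (hr : r * (10 * (d * H ^ 2 / γ)) ≤ 1) :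
    ∫ ω, W ω * Real.exp (r * (deviation φ γ (p ω) (q ω) (fun l => M.value (θ ω) (Pi l)) i (c ω)
        (fun h => M.loss (θ ω h) (T ω h)) - (2 * b * sqNormSum φ (p ω) i +
        (8 * (γ * H) + 4 * (d * H ^ 2 / γ * ε) + 44 * b * (d * H))))) ∂P ≤ ∫ ω, W ω ∂P := by
  classical
  have hd : 0 < d := M.dim_pos (Pi i)
  have hH : 0 < H := Nat.pos_of_ne_zero (NeZero.ne H)
  set D : Ω → ℝ := fun ω => 2 * b * sqNormSum φ (p ω) i +
    (8 * (γ * H) + 4 * (d * H ^ 2 / γ * ε) + 44 * b * (d * H)) with hDdef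
  set V : Ω → ι → ℝ := fun ω l => M.value (θ ω) (Pi l) with hVdef
  set y : Ω → Fin H → ℝ := fun ω h => M.loss (θ ω h) (T ω h) with hydef
  have hV : ∀ l, IsBddMeasurable m fun ω => V ω l := fun l => isBddMeasurable_value hθ hadm _
  have hVH : ∀ ω l, |V ω l| ≤ H := fun ω l => M.abs_value_le _ (hadm ω)
  have hy1 : ∀ ω h, |y ω h| ≤ 1 := fun ω h => (hadm ω).2 h _
  have hy : ∀ h, IsBddMeasurable mΩ fun ω => y ω h := fun h =>
    isBddMeasurable_loss (hθ.mono hm le_rfl) hT hadm h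
  have hD : IsBddMeasurable m D :=
    ((IsBddMeasurable.const _).mul (isBddMeasurable_sqNormSum hp hmix i)).add (.const _)
  set U : Ω → ℝ := fun ω => W ω * Real.exp (-r * D ω) with hUdef
  have hU : IsBddMeasurable m U := hW.mul ((IsBddMeasurable.const _).mul hD).exp
  have hU0 : ∀ ω, 0 ≤ U ω := fun ω => mul_nonneg (hW0 ω) (Real.exp_nonneg _)
  -- The polynomial bound for the exponential is `R j + ∑ h, β j h * y h` with `m`-measurable
  -- coefficients.
  set R : ι → Ω → ℝ := fun j ω => U ω * (1 + r * (V ω j - V ω i +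
    6 * (γ / (d * H)) * sqNormSum φ (p ω) j) + r ^ 2 * deviationSq φ γ (p ω) (q ω) i j) with hRdef
  set β : ι → Fin H → Ω → ℝ := fun j h ω => U ω * (r * diffCoeff φ (p ω) (q ω) i j h) with hβdef
  have hR : ∀ j, IsBddMeasurable m (R j) := fun j =>
    hU.mul (((IsBddMeasurable.const _).add ((IsBddMeasurable.const _).mul (((hV j).sub (hV i)).add
      ((IsBddMeasurable.const _).mul (isBddMeasurable_sqNormSum hp hmix j))))).add
      ((IsBddMeasurable.const _).mul (isBddMeasurable_deviationSq hp hq hmix i j)))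
  have hβ : ∀ j h, IsBddMeasurable m (β j h) := fun j h =>
    hU.mul ((IsBddMeasurable.const _).mul (isBddMeasurable_diffCoeff hp hq hmix i j h))
  have hpoly : ∀ j ω (z : Fin H → ℝ), U ω * (1 + r * deviation φ γ (p ω) (q ω) (V ω) i j z +
      r ^ 2 * deviationSq φ γ (p ω) (q ω) i j) = R j ω + ∑ h, β j h ω * z h := by
    intro j ω z
    have : ∑ h, β j h ω * z h = U ω * r * ∑ h, diffCoeff φ (p ω) (q ω) i j h * z h := by
      rw [Finset.mul_sum]
      exact Finset.sum_congr rfl fun h _ => by rw [hβdef]; ring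
    rw [this, hRdef, deviation]
    ring
  have hQ : ∀ j, IsBddMeasurable mΩ fun ω => R j ω + ∑ h, β j h ω * y ω h := fun j =>
    ((hR j).mono hm).add (.sum fun h _ => ((hβ j h).mono hm).mul (hy h))
  have hX : IsBddMeasurable mΩ fun ω => W ω * Real.exp (r *
      (deviation φ γ (p ω) (q ω) (V ω) i (c ω) (y ω) - D ω)) :=
    (hW.mono hm).mul ((IsBddMeasurable.const r).mul (IsBddMeasurable.sub
      (IsBddMeasurable.select (f := fun j ω => deviation φ γ (p ω) (q ω) (V ω) i j (y ω)) hc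
        fun j => isBddMeasurable_deviation (hp.mono hm le_rfl) (hq.mono hm le_rfl) hmix
          (fun l => (hV l).mono hm) hy i j) (hD.mono hm))).exp
  have hle : ∀ ω, W ω * Real.exp (r * (deviation φ γ (p ω) (q ω) (V ω) i (c ω) (y ω) - D ω)) ≤
      R (c ω) ω + ∑ h, β (c ω) h ω * y ω h := by
    intro ω
    rw [← hpoly]
    have h1 := (hmix ω).exp_deviation_le hd hH hγ hγ' (hVH ω) i (c ω) (hy1 ω) hr0 hr
    calc _ = U ω * Real.exp (r * deviation φ γ (p ω) (q ω) (V ω) i (c ω) (y ω)) := by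
          rw [hUdef, mul_assoc, ← Real.exp_add]
          congr 2
          ring
      _ ≤ _ := mul_le_mul_of_nonneg_left h1 (hU0 ω)
  have hsplit : ∫ ω, (R (c ω) ω + ∑ h, β (c ω) h ω * y ω h) ∂P =
      ∑ j, ∫ ω in c ⁻¹' {j}, (R j ω + ∑ h, β j h ω * y ω h) ∂P := by
    simp only [← fun j => integral_indicator (μ := P) (hc j)
      (f := fun ω => R j ω + ∑ h, β j h ω * y ω h)]
    rw [← integral_finsetSum _ fun j _ => (hQ j).integrable.indicator (hc j)]
    refine integral_congr_ae (ae_of_all _ fun ω => ?_)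
    simp only
    rw [Finset.sum_eq_single (c ω)]
    · simp
    · intro a _ ha
      simp [Ne.symm ha]
    · simp
  have hpiece : ∀ j, ∫ ω in c ⁻¹' {j}, (R j ω + ∑ h, β j h ω * y ω h) ∂P =
      ∫ ω, p ω j * (R j ω + ∑ h, β j h ω * inner ℝ (M.visitation (Pi j) h) (θ ω h)) ∂P := by
    intro j
    have hpj := isBddMeasurable_prob hp hmix j
    have hin : ∀ h, IsBddMeasurable m fun ω =>
        p ω j * (β j h ω * inner ℝ (M.visitation (Pi j) h) (θ ω h)) := fun h =>
      hpj.mul ((hβ j h).mul (isBddMeasurable_inner_theta hθ hadm h _))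
    simp only [mul_add, Finset.mul_sum]
    rw [integral_add ((hR j).mono hm).integrable.integrableOn
        (IsBddMeasurable.sum fun h _ =>
          ((hβ j h).mono hm).mul (hy h)).integrable.integrableOn,
      integral_finsetSum _ fun h _ => (((hβ j h).mono hm).mul (hy h)).integrable.integrableOn,
      integral_add ((hpj.mul (hR j)).mono hm).integrable
        ((IsBddMeasurable.sum fun h _ => hin h).mono hm).integrable,
      integral_finsetSum _ fun h _ => ((hin h).mono hm).integrable,
      setIntegral_eq_integral_prob_mul hm hp hmix hc hT hlaw (hR j)]
    congr 1
    exact Finset.sum_congr rfl fun h _ =>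
      setIntegral_mul_loss hm hp hmix hθ hadm hc hT hlaw (hβ j h) j h
  have hpieceInt : ∀ j, IsBddMeasurable m fun ω =>
      p ω j * (R j ω + ∑ h, β j h ω * inner ℝ (M.visitation (Pi j) h) (θ ω h)) := fun j =>
    (isBddMeasurable_prob hp hmix j).mul ((hR j).add (.sum fun h _ =>
      (hβ j h).mul (isBddMeasurable_inner_theta hθ hadm h _)))
  calc _ ≤ ∫ ω, (R (c ω) ω + ∑ h, β (c ω) h ω * y ω h) ∂P :=
        integral_mono hX.integrable (IsBddMeasurable.select hc hQ).integrable hle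
    _ = ∫ ω, ∑ j, p ω j *
          (R j ω + ∑ h, β j h ω * inner ℝ (M.visitation (Pi j) h) (θ ω h)) ∂P := by
        rw [hsplit, integral_finsetSum _ fun j _ => ((hpieceInt j).mono hm).integrable]
        exact Finset.sum_congr rfl fun j _ => hpiece j
    _ ≤ ∫ ω, W ω ∂P := by
        refine integral_mono ((IsBddMeasurable.sum fun j _ => hpieceInt j).mono hm).integrable
          (hW.mono hm).integrable fun ω => ?_
        simp only [← hpoly]
        have hVω : V ω = fun l => ∑ h, inner ℝ (M.visitation (Pi l) h) (θ ω h) :=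
          funext fun l => M.value_eq _ _
        have h1 := (hmix ω).sum_mul_one_add_deviation_le hd hH hγ hγ' hφ (hadm ω).1
          (fun l => by rw [← M.value_eq]; exact hVH ω l) i hr0 hrb
        rw [← hVω] at h1
        have h2 := mul_le_mul_of_nonneg_left h1 (hU0 ω)
        calc _ = U ω * ∑ j, p ω j * (1 + r * deviation φ γ (p ω) (q ω) (V ω) i j
              (fun h => inner ℝ (M.visitation (Pi j) h) (θ ω h)) +
              r ^ 2 * deviationSq φ γ (p ω) (q ω) i j) := by
              rw [Finset.mul_sum]
              exact Finset.sum_congr rfl fun j _ => by ring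
          _ ≤ _ := h2
          _ = W ω := by
              rw [hUdef, mul_assoc, ← Real.exp_add, hDdef]
              simp

end Step

/-! ### The regret bound -/

section Run

variable {S A ι Ω : Type*} [MeasurableSpace S] [MeasurableSpace A] [Fintype ι]
  {mΩ : MeasurableSpace Ω} {d H K : ℕ} [NeZero H] {M : LinearMDP S A d H}
  {Pi : ι → Policy S A H} {φ : ι → Fin H → EuclideanSpace ℝ (Fin d)} {g : Fin H → ι → ℝ}
  {γ δ ε : ℝ} {P : Measure Ω} {ℱ : Filtration ℕ mΩ}
  {θ : ℕ → Ω → Fin H → EuclideanSpace ℝ (Fin d)} {c : ℕ → Ω → ι}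
  {τ : ℕ → Ω → Fin H → S × A}

/-- The weights of the algorithm at the beginning of episode `k` as a random vector. -/
noncomputable def runWeight (M : LinearMDP S A d H) (φ : ι → Fin H → EuclideanSpace ℝ (Fin d))
    (g : Fin H → ι → ℝ) (γ δ : ℝ) (K : ℕ) (θ : ℕ → Ω → Fin H → EuclideanSpace ℝ (Fin d))
    (c : ℕ → Ω → ι) (τ : ℕ → Ω → Fin H → S × A) (k : ℕ) (ω : Ω) : ι → ℝ :=
  weight φ g γ δ K (fun j => c j ω) (fun j h => M.loss (θ j ω h) (τ j ω h)) k

/-- The increment of the logarithm of the exponential supermartingale, up to the factor `r`: the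
deviation in episode `k`, minus the compensation `2 b s` by the bonus of policy `i` and the constant
drift. -/
noncomputable def increment (M : LinearMDP S A d H) (Pi : ι → Policy S A H)
    (φ : ι → Fin H → EuclideanSpace ℝ (Fin d)) (γ ε b : ℝ) (w : ℕ → Ω → ι → ℝ)
    (p : ℕ → Ω → ι → ℝ) (θ : ℕ → Ω → Fin H → EuclideanSpace ℝ (Fin d)) (c : ℕ → Ω → ι)
    (τ : ℕ → Ω → Fin H → S × A) (i : ι) (k : ℕ) (ω : Ω) : ℝ :=
  deviation φ γ (p k ω) (normWeight (w k ω)) (fun l => M.value (θ k ω) (Pi l)) i (c k ω)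
      (fun h => M.loss (θ k ω h) (τ k ω h)) -
    (2 * b * sqNormSum φ (p k ω) i +
      (8 * (γ * H) + 4 * (d * H ^ 2 / γ * ε) + 44 * b * (d * H)))

theorem IsRun.measurable_runWeight (hrun : IsRun M Pi φ g γ δ K P ℱ θ c τ) {k : ℕ} (hk : k ≤ K) :
    Measurable[ℱ k] (runWeight M φ g γ δ K θ c τ k) :=
  measurable_weight φ g γ δ K
    (fun j hj a => ℱ.mono (Nat.succ_le_of_lt hj) _
      (hrun.measurable_policy j (hj.trans_le hk) a))
    fun j hj => measurable_loss ((hrun.measurable_theta j (hj.trans_le hk)).mono (ℱ.mono hj.le)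
      le_rfl) ((hrun.measurable_traj j (hj.trans_le hk)).mono (ℱ.mono (Nat.succ_le_of_lt hj))
        le_rfl)

/-- The exponentials of `r` times the partial sums of the increments are adapted and bounded, and
their means are at most `1`, the supermartingale property of one step being
`integral_mul_exp_deviation_le`. -/
theorem IsRun.isBddMeasurable_and_integral_exp_le [IsProbabilityMeasure P]
    (hrun : IsRun M Pi φ g γ δ K P ℱ θ c τ)
    (hγ : 0 < γ) (hγ' : γ ≤ 1 / 2)
    (hφ : ∀ l h, ‖φ l h - M.visitation (Pi l) h‖ ≤ ε / √(d : ℝ))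
    (hg : ∀ h, IsGOptimal (fun l => φ l h) (g h)) (i : ι) {r b : ℝ} (hr0 : 0 ≤ r)
    (hrb : 3 * H * r ≤ b) (hr : r * (10 * (d * H ^ 2 / γ)) ≤ 1) {n : ℕ} (hn : n ≤ K) :
    IsBddMeasurable (ℱ n) (fun ω => Real.exp (r * ∑ k ∈ Finset.range n,
      increment M Pi φ γ ε b (runWeight M φ g γ δ K θ c τ)
        (fun k ω => selectProb γ g (runWeight M φ g γ δ K θ c τ k ω)) θ c τ i k ω)) ∧
    ∫ ω, Real.exp (r * ∑ k ∈ Finset.range n,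
      increment M Pi φ γ ε b (runWeight M φ g γ δ K θ c τ)
        (fun k ω => selectProb γ g (runWeight M φ g γ δ K θ c τ k ω)) θ c τ i k ω) ∂P ≤ 1 := by
  have : Nonempty ι := ⟨i⟩
  set w := runWeight M φ g γ δ K θ c τ with hw
  set p : ℕ → Ω → ι → ℝ := fun k ω => selectProb γ g (w k ω) with hp
  have hmix : ∀ k ω, IsMixture φ γ (p k ω) (normWeight (w k ω)) := fun k ω =>
    isMixture_selectProb hγ hγ' hg fun l => weight_pos _ _ _ _ _ _ _ _ _
  induction n with
  | zero =>
    constructor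
    · simpa using IsBddMeasurable.const 1
    · simp
  | succ n ih =>
    have hnK : n < K := hn
    obtain ⟨hW, hint⟩ := ih hnK.le
    have hwm : Measurable[ℱ n] (w n) := hrun.measurable_runWeight hnK.le
    have hpm : Measurable[ℱ n] (p n) := measurable_selectProb hwm γ g
    have hqm := measurable_normWeight hwm
    have hle : ℱ n ≤ ℱ (n + 1) := ℱ.mono n.le_succ
    have hθ := hrun.measurable_theta n hnK
    have hadm := hrun.admissible_theta n hnK
    have hinc : IsBddMeasurable (ℱ (n + 1)) (increment M Pi φ γ ε b w p θ c τ i n) := by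
      refine IsBddMeasurable.sub ?_ (IsBddMeasurable.add (IsBddMeasurable.mul (.const _)
        ((isBddMeasurable_sqNormSum hpm (hmix n) i).mono hle)) (.const _))
      exact IsBddMeasurable.select
        (f := fun j ω => deviation φ γ (p n ω) (normWeight (w n ω))
          (fun l => M.value (θ n ω) (Pi l)) i j (fun h => M.loss (θ n ω h) (τ n ω h)))
        (hrun.measurable_policy n hnK) fun j =>
          isBddMeasurable_deviation (hpm.mono hle le_rfl) (hqm.mono hle le_rfl) (hmix n)
            (fun l => (isBddMeasurable_value hθ hadm _).mono hle)
            (fun h => isBddMeasurable_loss (hθ.mono hle le_rfl) (hrun.measurable_traj n hnK)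
              hadm h) i j
    simp only [Finset.sum_range_succ, mul_add, Real.exp_add]
    refine ⟨(hW.mono hle).mul ((IsBddMeasurable.const r).mul hinc).exp, le_trans ?_ hint⟩
    exact integral_mul_exp_deviation_le (ℱ.le n) hγ hγ' hφ hpm hqm (hmix n) hθ hadm
      (fun j => ℱ.le (n + 1) _ (hrun.measurable_policy n hnK j))
      ((hrun.measurable_traj n hnK).mono (ℱ.le (n + 1)) le_rfl)
      (fun j B hB => hrun.cond_law n hnK j B hB) hW (fun ω => Real.exp_nonneg _) i hr0 hrb hr

/-- Along every run, the regret is bounded by the sum of the increments and deterministic terms. -/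
theorem IsRun.regret_le_sum_increment (hrun : IsRun M Pi φ g γ δ K P ℱ θ c τ) (hγ : 0 < γ)
    (hγ' : γ ≤ 1 / 2) (hg : ∀ h, IsGOptimal (fun l => φ l h) (g h)) (i : ι)
    {b : ℝ} (hbdef : b = √(H * Real.log (1 / δ) / (d * K))) (hb : b ≤ 1 / 2) (ω : Ω) :
    ∑ k ∈ Finset.range K, (M.value (θ k ω) (Pi (c k ω)) - M.value (θ k ω) (Pi i)) ≤
      ∑ k ∈ Finset.range K, increment M Pi φ γ ε b (runWeight M φ g γ δ K θ c τ)
        (fun k ω => selectProb γ g (runWeight M φ g γ δ K θ c τ k ω)) θ c τ i k ω +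
      K * (8 * (γ * H) + 4 * (d * H ^ 2 / γ * ε) + 60 * b * (d * H)) +
      d * H ^ 2 / γ * Real.log (Fintype.card ι) := by
  have : Nonempty ι := ⟨i⟩
  have hd : 0 < d := M.dim_pos (Pi i)
  have hH : 0 < H := Nat.pos_of_ne_zero (NeZero.ne H)
  have hd' : (0 : ℝ) < d := Nat.cast_pos.2 hd
  have hH' : (0 : ℝ) < H := Nat.cast_pos.2 hH
  set w := runWeight M φ g γ δ K θ c τ with hw
  set p : ℕ → Ω → ι → ℝ := fun k ω => selectProb γ g (w k ω) with hp
  have hmix : ∀ k ω, IsMixture φ γ (p k ω) (normWeight (w k ω)) := fun k ω =>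
    isMixture_selectProb hγ hγ' hg fun l => weight_pos _ _ _ _ _ _ _ _ _
  set y : ℕ → Fin H → ℝ := fun k h => M.loss (θ k ω h) (τ k ω h) with hy
  have hy1 : ∀ k < K, ∀ h, |y k h| ≤ 1 := fun k hk h => (hrun.admissible_theta k hk ω).2 h _
  rw [hbdef] at hb
  have h1 := sum_normWeight_mul_le (w := fun k => w k ω)
    (v := fun k l => optValue φ δ K (p k ω) (c k ω) (y k) l) (η := γ / (d * H ^ 2)) (K := K)
    (by positivity) (fun l => rfl) (fun k l => rfl)
    (fun k hk l => (hmix k ω).abs_mul_optValue_le hd hH hγ hb (c k ω) (hy1 k hk) l) i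
  have h2 : ∑ k ∈ Finset.range K, (M.value (θ k ω) (Pi (c k ω)) - M.value (θ k ω) (Pi i)) ≤
      ∑ k ∈ Finset.range K, (increment M Pi φ γ ε b w p θ c τ i k ω +
        (8 * (γ * H) + 4 * (d * H ^ 2 / γ * ε) + 60 * b * (d * H)) +
        (∑ l, normWeight (w k ω) l * optValue φ δ K (p k ω) (c k ω) (y k) l -
          optValue φ δ K (p k ω) (c k ω) (y k) i - 3 / 2 * (γ / (d * H ^ 2)) *
          ∑ l, normWeight (w k ω) l * optValue φ δ K (p k ω) (c k ω) (y k) l ^ 2)) := by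
    refine Finset.sum_le_sum fun k hk => ?_
    have h3 := (hmix k ω).optValue_sub_add_le hd hH hγ hγ' hb (c k ω)
      (hy1 k (Finset.mem_range.1 hk)) i
    rw [← hbdef] at h3
    rw [increment, deviation]
    linarith
  have h4 : Real.log (Fintype.card ι) / (γ / (d * H ^ 2)) =
      d * H ^ 2 / γ * Real.log (Fintype.card ι) := by
    field_simp
  rw [h4] at h1
  refine h2.trans ?_
  rw [Finset.sum_add_distrib, Finset.sum_add_distrib, Finset.sum_const, Finset.card_range,
    nsmul_eq_mul]
  linarith

end Run

/-- If the bonus parameter `b = √(H L / (d K))` is not small, then the trivial bound `2 K H` of the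
regret is of the order of the main term. -/
theorem two_mul_le_of_half_lt_sqrt {d K H L : ℝ} (hd : 1 ≤ d) (hK : 0 < K) (hH : 0 ≤ H)
    (hb : 1 / 2 < √(H * L / (d * K))) : 2 * (K * H) ≤ 4 * (H * √(d * K * H * L)) := by
  have hdK : 0 < d * K := by positivity
  have h1 := (Real.lt_sqrt (by norm_num)).1 hb
  rw [lt_div_iff₀ hdK] at h1
  have h2 : d * K / 2 ≤ √(d * K * H * L) := by
    refine Real.le_sqrt_of_sq_le ?_
    nlinarith
  have h3 : K ≤ d * K := le_mul_of_one_le_left hK.le hd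
  nlinarith [mul_le_mul_of_nonneg_left h2 hH]

end GLAP

theorem lemma3 :
    ∃ C : ℝ, 0 < C ∧
      ∀ {S A ι Ω : Type*} [MeasurableSpace S] [MeasurableSpace A] [Fintype ι]
        {mΩ : MeasurableSpace Ω} (d H K : ℕ) [NeZero H]
        (M : GLAP.LinearMDP S A d H) (Pi : ι → GLAP.Policy S A H)
        (φ : ι → Fin H → EuclideanSpace ℝ (Fin d)) (g : Fin H → ι → ℝ) (γ δ ε : ℝ)
        (P : Measure Ω) [IsProbabilityMeasure P] (ℱ : Filtration ℕ mΩ)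
        (θ : ℕ → Ω → Fin H → EuclideanSpace ℝ (Fin d)) (c : ℕ → Ω → ι)
        (τ : ℕ → Ω → Fin H → S × A),
        0 < γ → γ ≤ 1 / 2 → 0 < δ → δ < 1 →
        (∀ i h, ‖φ i h - M.visitation (Pi i) h‖ ≤ ε / √(d : ℝ)) →
        (∀ h, GLAP.IsGOptimal (fun i => φ i h) (g h)) →
        GLAP.IsRun M Pi φ g γ δ K P ℱ θ c τ →
        ∀ i : ι,
          1 - δ ≤ P.real {ω |
            ∑ k ∈ Finset.range K, (M.value (θ k ω) (Pi (c k ω)) - M.value (θ k ω) (Pi i)) ≤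
              C * (H * √(d * K * H * Real.log (Fintype.card ι / δ))
                + d * H ^ 2 / γ * Real.log (Fintype.card ι / δ)
                + γ * K * H
                + d * H ^ 2 / γ * ε * K)} := by
  refine ⟨100, by norm_num, ?_⟩
  intro S A ι Ω _ _ _ mΩ d H K _ M Pi φ g γ δ ε P _ ℱ θ c τ hγ hγ' hδ hδ' hφ hg hrun i
  have : Nonempty ι := ⟨i⟩
  have hd : (1 : ℝ) ≤ d := Nat.one_le_cast.2 (M.dim_pos (Pi i))
  have hH : (1 : ℝ) ≤ H := Nat.one_le_cast.2 (Nat.pos_of_ne_zero (NeZero.ne H))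
  have hN : (1 : ℝ) ≤ Fintype.card ι := Nat.one_le_cast.2 Fintype.card_pos
  have hε : 0 ≤ ε := by
    have h := (norm_nonneg _).trans (hφ i 0)
    have hsd : 0 < √(d : ℝ) := Real.sqrt_pos.2 (by linarith)
    rwa [le_div_iff₀ hsd, zero_mul] at h
  set L := Real.log (1 / δ) with hL
  have hL0 : 0 < L := Real.log_pos (one_lt_one_div hδ hδ')
  have hlogN : 0 ≤ Real.log (Fintype.card ι) := Real.log_nonneg hN
  have hL' : Real.log (Fintype.card ι / δ) = Real.log (Fintype.card ι) + L := by
    rw [hL, ← Real.log_mul (by positivity) (by positivity), mul_one_div]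
  rw [hL']
  set L' := Real.log (Fintype.card ι) + L
  have hLL' : L ≤ L' := by linarith
  have hsq : √(d * K * H * L) ≤ √(d * K * H * L') := Real.sqrt_le_sqrt (by gcongr)
  have hR0 : 0 ≤ d * H ^ 2 / γ * L' := mul_nonneg (by positivity) (hL0.le.trans hLL')
  have hR1 : 0 ≤ γ * K * H := by positivity
  have hR2 : 0 ≤ d * H ^ 2 / γ * ε * K := by positivity
  set R := 100 * (H * √(d * K * H * L') + d * H ^ 2 / γ * L' + γ * K * H +
    d * H ^ 2 / γ * ε * K) with hR
  -- It suffices to consider the case that the regret bound is not trivial.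
  by_cases htriv : 2 * (K * H : ℝ) ≤ R
  · have huniv : {ω | ∑ k ∈ Finset.range K, (M.value (θ k ω) (Pi (c k ω)) -
        M.value (θ k ω) (Pi i)) ≤ R} = Set.univ := by
      refine Set.eq_univ_of_forall fun ω => ?_
      calc _ ≤ ∑ k ∈ Finset.range K, (2 * H : ℝ) := by
            refine Finset.sum_le_sum fun k hk => ?_
            have hadm := hrun.admissible_theta k (Finset.mem_range.1 hk) ω
            linarith [(abs_le.1 (M.abs_value_le (Pi (c k ω)) hadm)).2,
              (abs_le.1 (M.abs_value_le (Pi i) hadm)).1]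
        _ = 2 * (K * H) := by
            rw [Finset.sum_const, Finset.card_range, nsmul_eq_mul]
            ring
        _ ≤ R := htriv
    rw [huniv, probReal_univ]
    linarith
  have hK : (0 : ℝ) < K := by
    rcases (Nat.cast_nonneg (α := ℝ) K).eq_or_lt with h | h
    · exfalso
      apply htriv
      rw [← h, zero_mul, mul_zero]
      positivity
    · exact h
  set b := √(H * L / (d * K)) with hb
  have hb0 : 0 < b := Real.sqrt_pos.2 (by positivity)
  have hb1 : b ≤ 1 / 2 := by
    by_contra! hc
    apply htriv
    have h1 := GLAP.two_mul_le_of_half_lt_sqrt hd hK (by linarith) hc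
    have h2 : 0 ≤ (H : ℝ) * √(d * K * H * L') := by positivity
    have h3 : (H : ℝ) * √(d * K * H * L) ≤ H * √(d * K * H * L') := by gcongr
    linarith
  -- The identity `b d K = √(d K H L)` links the bonus with the main term.
  have hbQ : b * (d * K) = √(d * K * H * L) := by
    rw [hb, ← Real.sqrt_sq (by positivity : (0 : ℝ) ≤ d * K), ← Real.sqrt_mul (by positivity),
      Real.sqrt_sq (by positivity)]
    congr 1
    field_simp
  have hLb : H * L / b = b * (d * K) := by
    rw [div_eq_iff hb0.ne', mul_right_comm, ← sq, hb, Real.sq_sqrt (by positivity)]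
    field_simp
  set R₀ : ℝ := d * H ^ 2 / γ with hR₀
  have hR₀pos : 0 < R₀ := by positivity
  set r := min (b / (3 * H)) (1 / (10 * R₀)) with hr
  have hr0 : 0 < r := lt_min (by positivity) (by positivity)
  have hr1 : 3 * H * r ≤ b := by
    calc _ ≤ 3 * H * (b / (3 * H)) := by gcongr; exact min_le_left _ _
      _ = b := by field_simp
  have hr2 : r * (10 * R₀) ≤ 1 := by
    calc _ ≤ 1 / (10 * R₀) * (10 * R₀) := by gcongr; exact min_le_right _ _
      _ = 1 := by field_simp
  have hLr : L / r ≤ 3 * (b * (d * K)) + 10 * (R₀ * L) := by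
    have h1 : L / (b / (3 * H)) = 3 * (b * (d * K)) := by
      rw [← hLb]
      field_simp
    have h2 : L / (1 / (10 * R₀)) = 10 * (R₀ * L) := by
      field_simp
    have h3 : 0 ≤ 3 * (b * (d * K)) := by positivity
    have h4 : 0 ≤ 10 * (R₀ * L) := by positivity
    rcases min_choice (b / (3 * H)) (1 / (10 * R₀)) with h | h
    · rw [hr, h, h1]
      linarith
    · rw [hr, h, h2]
      linarith
  obtain ⟨hmeas, hint⟩ := hrun.isBddMeasurable_and_integral_exp_le hγ hγ' hφ hg i hr0.le hr1 hr2
    (le_refl K)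
  set Y : Ω → ℝ := fun ω => ∑ k ∈ Finset.range K,
    GLAP.increment M Pi φ γ ε b (GLAP.runWeight M φ g γ δ K θ c τ)
      (fun k ω => GLAP.selectProb γ g (GLAP.runWeight M φ g γ δ K θ c τ k ω)) θ c τ i k ω
  have hbdd := hmeas.mono (ℱ.le K)
  have hmarkov : P.real {ω | 1 / δ ≤ Real.exp (r * Y ω)} ≤ δ := by
    have h := mul_meas_ge_le_integral_of_nonneg (ae_of_all P fun ω => Real.exp_nonneg (r * Y ω))
      hbdd.integrable (1 / δ)
    have h1 := h.trans hint
    rwa [one_div_mul_eq_div, div_le_one hδ] at h1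
  have hset : MeasurableSet {ω | 1 / δ ≤ Real.exp (r * Y ω)} :=
    measurableSet_le measurable_const hbdd.1
  calc 1 - δ ≤ 1 - P.real {ω | 1 / δ ≤ Real.exp (r * Y ω)} := by linarith
    _ = P.real {ω | 1 / δ ≤ Real.exp (r * Y ω)}ᶜ := (probReal_compl_eq_one_sub hset).symm
    _ ≤ _ := by
      refine measureReal_mono fun ω hω => ?_
      have h1 : Real.exp (r * Y ω) < 1 / δ := not_le.1 hω
      have h2 : Y ω ≤ L / r := by
        rw [le_div_iff₀ hr0, mul_comm, hL, Real.le_log_iff_exp_le (by positivity)]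
        exact h1.le
      have h3 : _ ≤ Y ω + _ + _ := hrun.regret_le_sum_increment (ε := ε) hγ hγ' hg i hb hb1 ω
      have h4 : K * (8 * (γ * H) + 4 * (R₀ * ε) + 60 * b * (d * H)) =
          8 * (γ * K * H) + 4 * (R₀ * ε * K) + 60 * (H * (b * (d * K))) := by ring
      have h5 : b * (d * K) ≤ H * (b * (d * K)) :=
        le_mul_of_one_le_left (by positivity) hH
      have h6 : H * (b * (d * K)) ≤ H * √(d * K * H * L') := by
        rw [hbQ]
        gcongr
      have h7 : R₀ * L' = R₀ * Real.log (Fintype.card ι) + R₀ * L := mul_add _ _ _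
      have h8 : 0 ≤ R₀ * Real.log (Fintype.card ι) := by positivity
      have h9 : 0 ≤ R₀ * L := by positivity
      have h10 : 0 ≤ H * (b * (d * K)) := by positivity
      refine h3.trans ?_
      rw [h4]
      linarith
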